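/- Let $\pi:\hat X\to X$ be a standard Borel bundle with compact metric fibers: $\hat X, X$ are standard Borel spaces, $\pi$ is a measurable surjection, and there are a compact metric space $Y$, a Borel set $\mathcal E\subset X\times Y$ with nonempty compact sections $\mathcal E_x$, and a Borel isomorphism $\iota:\hat X\to\mathcal E$ over $X$ that restricts, for each $x$, to a homeomorphism $\pi^{-1}(x)\to\mathcal E_x$. For a standard Borel space $Z$ let $B(Z)$ be the space of bounded measurable functions $Z\to\mathbb R$. A linear operator $Q$ on $B(Z)$ is $\sigma$-Markov if it is positive, $Q1=1$, and $\varphi_n\downarrow 0$ pointwise implies $Q\varphi_n\downarrow 0$ pointwise. Such an operator is given by the transition kernel $q(z,A)=Q1_A(z)$, and its powers act on measurable $f:Z\to[-\infty,\infty)$ by $Q^nf=\int f^+\,dq^n-\int f^-\,dq^n$, with $\infty-\infty:=-\infty$. Let $\mathcal I(Q)$ be the convex set of probability measures $\nu$ with $\int Q\varphi\,d\nu=\int\varphi\,d\nu$ for all $\varphi\in B(Z)$; its extreme points are called ergodic. Let $\hat P$ and $P$ be $\sigma$-Markov operators on $B(\hat X)$ and $B(X)$ with $\hat P(\varphi\circ\pi)=(P\varphi)\circ\pi$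 for all $\varphi\in B(X)$. Let $\hat\phi_1:\hat X\to[-\infty,\infty)$ be measurable and upper semicontinuous on each fiber, and put, for $n\ge1$, $$\hat\phi_n:=\sum_{k=0}^{n-1}\hat P^k\hat\phi_1,\qquad \phi_n(x):=\sup_{z\in\pi^{-1}(x)}\hat\phi_n(z).$$ Let $\mu\in\mathcal I(P)$ with $\phi_1^+=\max\{0,\phi_1\}\in L^1(\mu)$, and let $\mathcal I_\mu(\hat P)$ be the set of $\hat\mu\in\mathcal I(\hat P)$ with $\pi_*\hat\mu=\mu$. Assume that there is a Borel set $K\subset\hat X$ such that (i) for every bounded measurable $\psi:\hat X\to\mathbb R$ that is continuous on each fiber, the restriction of $\hat P\psi$ to $\pi^{-1}(x)\setminus K$ is continuous for every $x\in X$; (ii) $\hat\phi_1=-\infty$ on $K$. Then the limit $$\Lambda(\mu):=\lim_{n\to\infty}\frac1n\int\phi_n\,d\mu=\inf_{n\ge1}\frac1n\int\phi_n\,d\mu\in[-\infty,\infty)$$ exists, and $$\Lambda(\mu)=\sup_{\hat\mu\in\mathcal I_\mu(\hat P)}\int\hat\phi_1\,d\hat\mu\qquad(\sup\emptyset:=-\infty).$$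 The set $\mathcal I_\mu(\hat P)$ is nonempty whenever $\Lambda(\mu)>-\infty$ or $K=\emptyset$. Whenever $\mathcal I_\mu(\hat P)$ is nonempty, the supremum is attained at an extreme point $\hat\mu$ of $\mathcal I_\mu(\hat P)$, and if $\mu$ is ergodic for $P$ then this $\hat\mu$ is ergodic for $\hat P$. Finally, if $\Lambda(\mu)>-\infty$, every $\hat\mu\in\mathcal I_\mu(\hat P)$ with $\int\hat\phi_1\,d\hat\mu=\Lambda(\mu)$ satisfies $\hat\mu(K)=0$. -/

import Mathlib

open MeasureTheory Filter Topology
open scoped NNReal ENNReal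

noncomputable section

/-! ## Bounded measurable functions and `σ`-Markov operators -/

/-- The space `B(Z)` of bounded measurable real functions on `Z`. -/
def BddMeas (Z : Type*) [MeasurableSpace Z] : Submodule ℝ (Z → ℝ) where
  carrier := {f | Measurable f ∧ ∃ C : ℝ, ∀ z, |f z| ≤ C}
  zero_mem' := ⟨measurable_const, 0, fun z => by simp⟩
  add_mem' := by
    rintro f g ⟨hf, C, hC⟩ ⟨hg, D, hD⟩
    exact ⟨hf.add hg, C + D, fun z => (abs_add_le _ _).trans (add_le_add (hC z) (hD z))⟩
  smul_mem' := by
    rintro c f ⟨hf, C, hC⟩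
    refine ⟨hf.const_smul c, |c| * C, fun z => ?_⟩
    simp only [Pi.smul_apply, smul_eq_mul, abs_mul]
    exact mul_le_mul_of_nonneg_left (hC z) (abs_nonneg c)

/-- The constant function `1` as an element of `B(Z)`. -/
def BddMeas.one (Z : Type*) [MeasurableSpace Z] : BddMeas Z :=
  ⟨fun _ => 1, measurable_const, 1, fun _ => by simp⟩

/-- The indicator function of a measurable set as an element of `B(Z)`. -/
def BddMeas.ind {Z : Type*} [MeasurableSpace Z] (A : Set Z) (hA : MeasurableSet A) : BddMeas Z :=
  ⟨A.indicator fun _ => 1, measurable_const.indicator hA, 1, fun z => by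
    by_cases h : z ∈ A <;> simp [h]⟩

/-- The pullback `φ ↦ φ ∘ π` from `B(X)` to `B(E)`. -/
def BddMeas.pullback {E X : Type*} [MeasurableSpace E] [MeasurableSpace X] (π : E → X)
    (hπ : Measurable π) (φ : BddMeas X) : BddMeas E :=
  ⟨fun z => φ.1 (π z), φ.2.1.comp hπ, φ.2.2.imp fun _ h z => h (π z)⟩

/-- A `σ`-Markov operator on `B(Z)`: linear, positive, preserving `1`, and `σ`-order continuous
(`φ n ↓ 0` pointwise implies `Q (φ n) ↓ 0` pointwise; that `Q (φ n)` decreases is positivity). -/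
structure SigmaMarkov (Z : Type*) [MeasurableSpace Z] where
  toLin : BddMeas Z →ₗ[ℝ] BddMeas Z
  nonneg : ∀ φ : BddMeas Z, (∀ z, 0 ≤ φ.1 z) → ∀ z, 0 ≤ (toLin φ).1 z
  map_one : toLin (BddMeas.one Z) = BddMeas.one Z
  sigma_cont : ∀ φ : ℕ → BddMeas Z, (∀ z, Antitone fun n => (φ n).1 z) →
    (∀ z, Tendsto (fun n => (φ n).1 z) atTop (𝓝 0)) →
    ∀ z, Tendsto (fun n => (toLin (φ n)).1 z) atTop (𝓝 0)

namespace SigmaMarkov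

variable {Z : Type*} [MeasurableSpace Z]

theorem mono (Q : SigmaMarkov Z) {φ ψ : BddMeas Z} (h : ∀ z, φ.1 z ≤ ψ.1 z) (z : Z) :
    (Q.toLin φ).1 z ≤ (Q.toLin ψ).1 z := by
  have h1 := Q.nonneg (ψ - φ) (fun z => sub_nonneg.2 (h z)) z
  rw [map_sub] at h1
  exact sub_nonneg.1 h1

/-- The powers `Q ^ n` of a `σ`-Markov operator. -/
def iter (Q : SigmaMarkov Z) : ℕ → SigmaMarkov Z
  | 0 => ⟨LinearMap.id, fun _ h => h, rfl, fun _ _ h => h⟩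
  | n + 1 => ⟨Q.toLin ∘ₗ (Q.iter n).toLin,
      fun φ h => Q.nonneg _ ((Q.iter n).nonneg φ h),
      by rw [LinearMap.comp_apply, (Q.iter n).map_one, Q.map_one],
      fun φ h1 h2 => Q.sigma_cont (fun k => (Q.iter n).toLin (φ k))
        (fun z _ _ hab => (Q.iter n).mono (fun w => h1 w hab) z)
        ((Q.iter n).sigma_cont φ h1 h2)⟩

theorem ind_iUnion_aux (Q : SigmaMarkov Z) (z : Z) (f : ℕ → Set Z)
    (hf : ∀ i, MeasurableSet (f i)) (hd : Pairwise (Function.onFun Disjoint f)) :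
    ENNReal.ofReal ((Q.toLin (BddMeas.ind (⋃ i, f i) (MeasurableSet.iUnion hf))).1 z) =
      ∑' i, ENNReal.ofReal ((Q.toLin (BddMeas.ind (f i) (hf i))).1 z) := by
  have hpos : ∀ i, 0 ≤ (Q.toLin (BddMeas.ind (f i) (hf i))).1 z := fun i =>
    Q.nonneg _ (fun w => Set.indicator_nonneg (fun _ _ => zero_le_one) w) z
  let g : ℕ → BddMeas Z := fun n =>
    BddMeas.ind (⋃ i, f i) (MeasurableSet.iUnion hf) -
      ∑ i ∈ Finset.range n, BddMeas.ind (f i) (hf i)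
  have hsum : ∀ w, HasSum (fun i => (f i).indicator (fun _ => (1 : ℝ)) w)
      ((⋃ i, f i).indicator (fun _ => (1 : ℝ)) w) := by
    intro w
    by_cases hw : w ∈ ⋃ i, f i
    · obtain ⟨j, hj⟩ := Set.mem_iUnion.1 hw
      have : (⋃ i, f i).indicator (fun _ => (1 : ℝ)) w = (f j).indicator (fun _ => (1 : ℝ)) w := by
        simp only [Set.indicator_of_mem hw, Set.indicator_of_mem hj]
      rw [this]
      refine hasSum_single j fun i hij => Set.indicator_of_notMem (fun hi => ?_) _
      exact Set.disjoint_left.1 (hd hij) hi hj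
    · rw [Set.indicator_of_notMem hw]
      convert hasSum_zero using 2 with i
      exact Set.indicator_of_notMem (fun hi => hw (Set.mem_iUnion.2 ⟨i, hi⟩)) _
  have gval : ∀ n w, (g n).1 w = (⋃ i, f i).indicator (fun _ => (1 : ℝ)) w -
      ∑ i ∈ Finset.range n, (f i).indicator (fun _ => (1 : ℝ)) w := by
    intro n w
    simp [g, BddMeas.ind]
  have h0 := Q.sigma_cont g
    (fun w => antitone_nat_of_succ_le fun n => by
      simp only [gval, Finset.sum_range_succ]
      have : 0 ≤ (f n).indicator (fun _ => (1 : ℝ)) w :=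
        Set.indicator_nonneg (fun _ _ => zero_le_one) w
      linarith)
    (fun w => by
      simp only [gval]
      have h := (tendsto_const_nhds (x := (⋃ i, f i).indicator (fun _ => (1 : ℝ)) w)).sub
        (hsum w).tendsto_sum_nat
      rwa [sub_self] at h) z
  have hlim : Tendsto
      (fun n => ∑ i ∈ Finset.range n, (Q.toLin (BddMeas.ind (f i) (hf i))).1 z) atTop
      (𝓝 ((Q.toLin (BddMeas.ind (⋃ i, f i) (MeasurableSet.iUnion hf))).1 z)) := by
    have h1 := (tendsto_const_nhds (x := (Q.toLin (BddMeas.ind (⋃ i, f i)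
      (MeasurableSet.iUnion hf))).1 z)).sub h0
    rw [sub_zero] at h1
    refine h1.congr fun n => ?_
    simp [g, map_sub, map_sum]
  have h2 := ENNReal.tendsto_ofReal hlim
  simp only [ENNReal.ofReal_sum_of_nonneg (fun i _ => hpos i)] at h2
  exact tendsto_nhds_unique h2 ENNReal.summable.hasSum.tendsto_sum_nat

/-- The transition kernel of a `σ`-Markov operator: `q(z, A) = (Q 1_A)(z)`. -/
def kernel (Q : SigmaMarkov Z) (z : Z) : Measure Z :=
  Measure.ofMeasurable
    (fun A hA => ENNReal.ofReal ((Q.toLin (BddMeas.ind A hA)).1 z))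
    (by
      have : BddMeas.ind (∅ : Set Z) MeasurableSet.empty = 0 := by
        ext w; simp [BddMeas.ind]
      simp [this])
    (fun f hf hd => Q.ind_iUnion_aux z f hf hd)

end SigmaMarkov

/-- The integral in `[-∞, ∞]` of an extended real function, `∫ f⁺ - ∫ f⁻`, where a difference
`∞ - ∞` is read as `-∞`. For functions with values in `[-∞, ∞)` this equals
`sup_N ∫ min (f, N)`. -/
def extInt {Z : Type*} [MeasurableSpace Z] (ν : Measure Z) (f : Z → EReal) : EReal :=
  ((∫⁻ z, (f z).toENNReal ∂ν : ℝ≥0∞) : EReal) - ((∫⁻ z, (-(f z)).toENNReal ∂ν : ℝ≥0∞) : EReal)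

/-- The action of a `σ`-Markov operator on extended real functions, by integration
against its transition kernel. -/
def SigmaMarkov.extend {Z : Type*} [MeasurableSpace Z] (Q : SigmaMarkov Z) (f : Z → EReal)
    (z : Z) : EReal :=
  extInt (Q.kernel z) f

/-- The set `I(Q)` of invariant probability measures of `Q`: `∫ Q φ dν = ∫ φ dν`
for all `φ ∈ B(Z)`. -/
def invariantMeasures {Z : Type*} [MeasurableSpace Z] (Q : SigmaMarkov Z) : Set (Measure Z) :=
  {ν | IsProbabilityMeasure ν ∧ ∀ φ : BddMeas Z, ∫ z, (Q.toLin φ).1 z ∂ν = ∫ z, φ.1 z ∂ν}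

/-- The ergodic measures of `Q` are the extreme points of `I(Q)`. -/
def IsErgodicFor {Z : Type*} [MeasurableSpace Z] (Q : SigmaMarkov Z) (ν : Measure Z) : Prop :=
  ν ∈ Set.extremePoints ℝ≥0 (invariantMeasures Q)

/-! ## Standard Borel bundles with compact metric fibers -/

/-- A Borel bundle with compact metric fibers: a measurable surjection `proj : E → X`, together
with a Borel isomorphism `chart` of `E` onto a Borel subset of `X × Y` (`Y` compact metric) over
`X`, all of whose sections are compact. Fibers carry the topology that `chart` transports from
the sections. -/
structure CompactFiberBundle (E X Y : Type*) [MeasurableSpace E] [MeasurableSpace X]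
    [MetricSpace Y] [MeasurableSpace Y] where
  proj : E → X
  measurable_proj : Measurable proj
  surjective_proj : Function.Surjective proj
  chart : E → X × Y
  measurableEmbedding_chart : MeasurableEmbedding chart
  fst_chart : ∀ z, (chart z).1 = proj z
  isCompact_section : ∀ x, IsCompact {y : Y | (x, y) ∈ Set.range chart}

namespace CompactFiberBundle

variable {E X Y : Type*} [MeasurableSpace E] [MeasurableSpace X] [MetricSpace Y]
  [MeasurableSpace Y]

/-- The topology on `E` induced by the `Y`-coordinate of the chart. It is used only through its
restriction to single fibers `proj ⁻¹' {x}`, where it is the topology that makes the chart a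
homeomorphism onto the section over `x`. -/
abbrev fiberTopology (π : CompactFiberBundle E X Y) : TopologicalSpace E :=
  TopologicalSpace.induced (fun z => (π.chart z).2) inferInstance

/-- The restriction of `ψ` to `proj ⁻¹' {x} \ K` is continuous for every `x`. -/
def FiberwiseContinuousOff (π : CompactFiberBundle E X Y) (K : Set E) (ψ : E → ℝ) : Prop :=
  ∀ x, @ContinuousOn E ℝ π.fiberTopology _ ψ (π.proj ⁻¹' {x} \ K)

/-- The restriction of `ψ` to every fiber is continuous. -/
def FiberwiseContinuous (π : CompactFiberBundle E X Y) (ψ : E → ℝ) : Prop :=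
  ∀ x, @ContinuousOn E ℝ π.fiberTopology _ ψ (π.proj ⁻¹' {x})

/-- The restriction of `u` to every fiber is upper semicontinuous. -/
def FiberwiseUSC (π : CompactFiberBundle E X Y) (u : E → EReal) : Prop :=
  ∀ x, @UpperSemicontinuousOn E EReal π.fiberTopology _ u (π.proj ⁻¹' {x})

/-- The fiberwise supremum `(M u)(x) = sup {u z : proj z = x}`. -/
def fiberSup (π : CompactFiberBundle E X Y) (u : E → EReal) (x : X) : EReal :=
  ⨆ z ∈ π.proj ⁻¹' {x}, u z

/-- The invariant lifts of `μ`: the `Phat`-invariant probability measures that project to `μ`. -/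
def invariantLifts (π : CompactFiberBundle E X Y) (Phat : SigmaMarkov E) (μ : Measure X) :
    Set (Measure E) :=
  {m | m ∈ invariantMeasures Phat ∧ m.map π.proj = μ}

end CompactFiberBundle

/-- The sums `∑_{k < n} Q ^ k f`. -/
def additiveSeq {Z : Type*} [MeasurableSpace Z] (Q : SigmaMarkov Z) (f : Z → EReal) (n : ℕ)
    (z : Z) : EReal :=
  ∑ k ∈ Finset.range n, (Q.iter k).extend f z

/-- The growth rate `inf_{n ≥ 1} (1/n) ∫ ψ n dν` of a sequence of extended real functions. -/
def growthRate {Z : Type*} [MeasurableSpace Z] (ν : Measure Z) (ψ : ℕ → Z → EReal) : EReal :=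
  ⨅ (n : ℕ) (_ : 1 ≤ n), extInt ν (ψ n) / (n : EReal)

end

/-! ## Analytic sets are null measurable, and measurable selections -/

/-! The problem is one of minimal cost. Choose a finite measurable `G` on the base, `μ`-integrable,
that bounds the positive part of `φhat` on almost every fiber, and write `φhat = G ∘ π - v` there.
Then `v ≥ 0` is fiberwise lower semicontinuous and infinite on `K`. With `γ = ∫ G dμ`, invariance of
`μ` gives `∫ φ_n dμ = n γ - b_n`, where `b_n` is the integral of the fiberwise infimum of `∑_{k<n}
Phat^k v`. By measurable selection, `b_n` is also the infimum, over lifts `ν` of `μ`, of the total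
cost of `n` steps started from `ν`. Cutting a path in two makes `b` superadditive, so `b_n / n`
tends to its supremum `S`, and `Λ = γ - S`. An invariant lift pays `∫ v` at each step, whence `S ≤ ∫
v` and one inequality of the formula.

For the other inequality, a Krylov-Bogoliubov argument is run on lifts that are nearly optimal for
`n` steps. Their time averages lie over `μ`, are almost invariant and have cost at most `S + 1/n`.
Two points need care.

Compactness: `E` is embedded in Cantor space times `Y`, where weak limits exist. All measures have
the same marginal on the base, so the portmanteau inequality extends from open sets to measurable
sets with open sections (`measure_le_liminf_of_isOpen_sections`). Hence no mass leaves `E`, and `∫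
v` is lower semicontinuous.

Invariance of the limit: `Phat f` is fiberwise continuous only off `K`, hence on each `{v ≤ c}`. The
bound on `∫ v` makes the mass outside `{v ≤ c}` uniformly small
(`lintegral_le_liminf_of_isFiberwiseContinuousOn`).

For an extreme optimal lift, minimize `∫ v`, then maximize a strictly convex functional among the
minimizers (`exists_extremePoint_isMinOn`). If `S = ∞`, every lift has value `-∞`, and `v` is
replaced by a function built in the manner of Lusin's theorem that is integrable for a given lift.
-/

theorem exists_isCompact_lt_measure_image {X : Type*} [TopologicalSpace X] [MeasurableSpace X]
    {μ : Measure X} [μ.OuterRegular] {g : (ℕ → ℕ) → X} (hg : Continuous g) {c : ℝ≥0∞}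
    (hc : c < μ (Set.range g)) : ∃ T : Set (ℕ → ℕ), IsCompact T ∧ c ≤ μ (g '' T) := by
  have step : ∀ (k : ℕ) (S : {S : Set (ℕ → ℕ) // c < μ (g '' S)}),
      ∃ n : ℕ, c < μ (g '' (S.1 ∩ {x | x k ≤ n})) := by
    rintro k ⟨S, hS⟩
    have hU : g '' S = ⋃ n : ℕ, g '' (S ∩ {x | x k ≤ n}) := by
      rw [← Set.image_iUnion, ← Set.inter_iUnion]
      congr 1
      ext x
      simp only [Set.mem_inter_iff, Set.mem_iUnion, Set.mem_ofPred_eq, iff_self_and]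
      exact fun _ => ⟨x k, le_rfl⟩
    have hmono : Monotone fun n : ℕ => g '' (S ∩ {x | x k ≤ n}) := fun a b hab =>
      Set.image_mono (Set.inter_subset_inter_right _ fun x hx => le_trans hx hab)
    rw [hU, hmono.measure_iUnion] at hS
    exact lt_iSup_iff.1 hS
  choose N hN using step
  -- Coordinates are bounded one at a time, keeping the measure of the image above `c`; all the
  -- bounds together cut out a compact product.
  let S : ℕ → {S : Set (ℕ → ℕ) // c < μ (g '' S)} := fun k =>
    Nat.rec ⟨Set.univ, by rwa [Set.image_univ]⟩ (fun k S => ⟨S.1 ∩ {x | x k ≤ N k S}, hN k S⟩) k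
  let b : ℕ → ℕ := fun k => N k (S k)
  have hS : ∀ k, (S k).1 = {x | ∀ i < k, x i ≤ b i} := by
    intro k
    induction k with
    | zero => ext x; simp [S]
    | succ k ih =>
      have : (S (k + 1)).1 = (S k).1 ∩ {x | x k ≤ b k} := rfl
      rw [this, ih]
      ext x
      simp only [Set.mem_inter_iff, Set.mem_ofPred_eq, Nat.lt_succ_iff_lt_or_eq]
      constructor
      · rintro ⟨h1, h2⟩ i (hi | rfl)
        exacts [h1 i hi, h2]
      · exact fun h => ⟨fun i hi => h i (Or.inl hi), h k (Or.inr rfl)⟩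
  have hT : IsCompact (Set.pi Set.univ fun i => Set.Iic (b i)) :=
    isCompact_univ_pi fun i => (Set.finite_Iic (b i)).isCompact
  refine ⟨_, hT, ?_⟩
  rw [Set.measure_eq_iInf_isOpen]
  refine le_iInf₂ fun U hU => le_iInf fun hUo => ?_
  by_contra! hlt
  have hex : ∀ k, ∃ x ∈ (S k).1, g x ∉ U := by
    intro k
    by_contra! h
    exact absurd ((S k).2.trans_le (measure_mono (Set.image_subset_iff.2 h))) hlt.not_gt
  choose x hxS hxU using hex
  -- The truncation lies in the compact product and agrees with `x k` in the coordinates below `k`,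
  -- so both sequences have the same limits along subsequences.
  let y : ℕ → ℕ → ℕ := fun k i => min (x k i) (b i)
  obtain ⟨z, hz, φ, hφ, hlim⟩ := hT.tendsto_subseq (x := y)
    (fun k i _ => min_le_right (x k i) (b i))
  have hxlim : Tendsto (x ∘ φ) atTop (𝓝 z) := by
    rw [tendsto_pi_nhds] at hlim ⊢
    intro i
    refine (hlim i).congr' ?_
    filter_upwards [eventually_gt_atTop i] with k hk
    have h1 := hxS (φ k)
    rw [hS] at h1
    exact min_eq_left (h1 i (hk.trans_le (hφ.id_le k)))
  have hzU : g z ∈ U := hU ⟨z, hz, rfl⟩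
  have := (hg.tendsto z).comp hxlim
  obtain ⟨k, hk⟩ := (this.eventually (hUo.mem_nhds hzU)).exists
  exact hxU _ hk

/-- Countably many compact images exhaust the measure of the range, which is thus squeezed between
this union and its measurable hull. -/
theorem nullMeasurableSet_range_of_continuous {X : Type*} [TopologicalSpace X] [T2Space X]
    [MeasurableSpace X] [BorelSpace X] {μ : Measure X} [IsFiniteMeasure μ] [μ.OuterRegular]
    {g : (ℕ → ℕ) → X} (hg : Continuous g) : NullMeasurableSet (Set.range g) μ := by
  rcases eq_or_ne (μ (Set.range g)) 0 with h0 | h0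
  · exact NullMeasurableSet.of_null h0
  obtain ⟨c, -, hc, hclim⟩ := exists_seq_strictMono_tendsto' (pos_iff_ne_zero.2 h0)
  choose T hT hcT using fun n => exists_isCompact_lt_measure_image hg (hc n).2
  have hm : MeasurableSet (⋃ n, g '' T n) :=
    MeasurableSet.iUnion fun n => ((hT n).image hg).measurableSet
  have hsub : (⋃ n, g '' T n) ⊆ Set.range g := Set.iUnion_subset fun n => Set.image_subset_range _ _
  have hle : μ (Set.range g) ≤ μ (⋃ n, g '' T n) :=
    le_of_tendsto' hclim fun n => (hcT n).trans
      (measure_mono (Set.subset_iUnion (fun n => g '' T n) n))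
  have hae : (⋃ n, g '' T n) =ᵐ[μ] toMeasurable μ (Set.range g) :=
    ae_eq_of_subset_of_measure_ge (hsub.trans (subset_toMeasurable _ _))
      (by rwa [measure_toMeasurable]) hm.nullMeasurableSet (measure_ne_top _ _)
  refine hm.nullMeasurableSet.congr ?_
  refine (LE.le.eventuallyLE hsub).antisymm ?_
  exact (LE.le.eventuallyLE (subset_toMeasurable μ (Set.range g))).trans hae.symm.le

theorem MeasureTheory.AnalyticSet.nullMeasurableSet {X : Type*} [TopologicalSpace X] [T2Space X]
    [MeasurableSpace X] [BorelSpace X] {μ : Measure X} [IsFiniteMeasure μ] [μ.OuterRegular]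
    {s : Set X} (hs : AnalyticSet s) : NullMeasurableSet s μ := by
  rw [AnalyticSet] at hs
  rcases hs with rfl | ⟨g, hg, rfl⟩
  · exact MeasurableSet.empty.nullMeasurableSet
  · exact nullMeasurableSet_range_of_continuous hg

theorem MeasurableSet.nullMeasurableSet_image {E X : Type*} [MeasurableSpace E]
    [StandardBorelSpace E] [MeasurableSpace X] [StandardBorelSpace X] {f : E → X}
    (hf : Measurable f) {A : Set E} (hA : MeasurableSet A) (μ : Measure X) [IsFiniteMeasure μ] :
    NullMeasurableSet (f '' A) μ := by
  let := upgradeStandardBorel X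
  exact (hA.analyticSet_image hf).nullMeasurableSet

/-! ### Leftmost branches and the measurable selection theorem -/

section Selection

variable {X : Type*} (g : (ℕ → ℕ) → X)

/-- The set of points with a `g`-preimage whose first `k` coordinates form the list `l`. -/
noncomputable def branchImage (k : ℕ) (l : List ℕ) : Set X := g '' {x | (List.range k).map x = l}

/-- The first `k` coordinates of the leftmost branch of the tree of `g`-preimages of `c`. -/
noncomputable def leftmostPrefix (c : X) : ℕ → List ℕ
  | 0 => []
  | k + 1 => leftmostPrefix c k ++
      [sInf {n | c ∈ branchImage g (k + 1) (leftmostPrefix c k ++ [n])}]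

/-- The leftmost branch of the tree of `g`-preimages of `c`. -/
noncomputable def leftmostBranch (c : X) (k : ℕ) : ℕ :=
  sInf {n | c ∈ branchImage g (k + 1) (leftmostPrefix g c k ++ [n])}

theorem leftmostPrefix_eq (c : X) (k : ℕ) :
    leftmostPrefix g c k = (List.range k).map (leftmostBranch g c) := by
  induction k with
  | zero => rfl
  | succ k ih => rw [List.range_succ, List.map_append, ← ih]; rfl

theorem mem_branchImage_leftmostPrefix {c : X} (hc : c ∈ Set.range g) (k : ℕ) :
    c ∈ branchImage g k (leftmostPrefix g c k) := by
  induction k with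
  | zero => obtain ⟨x, rfl⟩ := hc; exact ⟨x, rfl, rfl⟩
  | succ k ih =>
    obtain ⟨x, hx, rfl⟩ := ih
    exact Nat.sInf_mem (s := {n | g x ∈ branchImage g (k + 1) (leftmostPrefix g (g x) k ++ [n])})
      ⟨x k, x, by
      rw [Set.mem_ofPred_eq] at hx ⊢
      rw [List.range_succ, List.map_append, hx]; rfl, rfl⟩

/-- For each `k` some preimage of `c` shares its first `k` coordinates with the branch. These
preimages converge to the branch, and `g` is continuous. -/
theorem apply_leftmostBranch [TopologicalSpace X] [T2Space X] (hg : Continuous g) {c : X}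
    (hc : c ∈ Set.range g) : g (leftmostBranch g c) = c := by
  choose x hx hxc using mem_branchImage_leftmostPrefix g hc
  have hlim : Tendsto x atTop (𝓝 (leftmostBranch g c)) := by
    rw [tendsto_pi_nhds]
    intro i
    refine tendsto_const_nhds.congr' ?_
    filter_upwards [eventually_gt_atTop i] with k hk
    have h := hx k
    rw [Set.mem_ofPred_eq, leftmostPrefix_eq, List.map_inj_left] at h
    exact (h i (List.mem_range.2 hk)).symm
  have h2 := (hg.tendsto _).comp hlim
  refine tendsto_nhds_unique h2 ?_
  simp only [Function.comp_def, hxc]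
  exact tendsto_const_nhds

theorem nullMeasurable_leftmostBranch [MeasurableSpace X] {μ : Measure X}
    (h : ∀ k l, NullMeasurableSet (branchImage g k l) μ) :
    NullMeasurable (leftmostBranch g) μ := by
  have key : ∀ k l n, NullMeasurableSet
      {c | sInf {n | c ∈ branchImage g (k + 1) (l ++ [n])} = n} μ := by
    intro k l n
    have : {c | sInf {n | c ∈ branchImage g (k + 1) (l ++ [n])} = n} =
        (branchImage g (k + 1) (l ++ [n]) ∩ ⋂ m : Set.Iio n, (branchImage g (k + 1) (l ++ [m.1]))ᶜ)
        -- This term accounts for the convention `sInf ∅ = 0`.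
        ∪ {c | n = 0} ∩ (⋃ n, branchImage g (k + 1) (l ++ [n]))ᶜ := by
      ext c
      simp only [Set.mem_union, Set.mem_inter_iff, Set.mem_iInter, Set.mem_compl_iff,
        Set.mem_iUnion, Set.mem_ofPred_eq, not_exists, Subtype.forall, Set.mem_Iio]
      by_cases hne : ∃ n, c ∈ branchImage g (k + 1) (l ++ [n])
      · constructor
        · rintro rfl
          exact Or.inl ⟨Nat.sInf_mem hne, fun m hm => Nat.notMem_of_lt_sInf hm⟩
        · rintro (⟨h1, h2⟩ | ⟨-, h2⟩)
          · refine le_antisymm (Nat.sInf_le h1) ?_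
            by_contra! hlt
            exact h2 _ hlt (Nat.sInf_mem hne)
          · exact absurd hne (by simpa using h2)
      · have he : {n | c ∈ branchImage g (k + 1) (l ++ [n])} = ∅ := by
          ext m
          simpa using fun hm => hne ⟨m, hm⟩
        push Not at hne
        rw [he, Nat.sInf_empty]
        constructor
        · exact fun h => Or.inr ⟨h.symm, hne⟩
        · rintro (⟨h1, -⟩ | ⟨h1, -⟩)
          exacts [absurd h1 (hne n), h1.symm]
    rw [this]
    exact ((h _ _).inter (NullMeasurableSet.iInter fun m => (h _ _).compl)).union
      ((MeasurableSet.const _).nullMeasurableSet.inter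
        (NullMeasurableSet.iUnion fun n => h _ _).compl)
  have hpre : ∀ k l, NullMeasurableSet {c | leftmostPrefix g c k = l} μ := by
    intro k
    induction k with
    | zero => exact fun l => (MeasurableSet.const ([] = l)).nullMeasurableSet
    | succ k ih =>
      intro l
      have : {c | leftmostPrefix g c (k + 1) = l} = ⋃ (p : List ℕ × ℕ) (_ : p.1 ++ [p.2] = l),
          {c | leftmostPrefix g c k = p.1} ∩
            {c | sInf {n | c ∈ branchImage g (k + 1) (p.1 ++ [n])} = p.2} := by
        ext c
        simp only [Set.mem_iUnion, Set.mem_inter_iff, Set.mem_ofPred_eq, exists_prop, Prod.exists]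
        constructor
        · exact fun h => ⟨_, _, h, rfl, rfl⟩
        · rintro ⟨a, n, h1, rfl, rfl⟩
          exact h1
      rw [this]
      exact NullMeasurableSet.iUnion fun p => NullMeasurableSet.iUnion fun _ =>
        (ih _).inter (key _ _ _)
  have hcoord : ∀ k n, NullMeasurableSet {c | leftmostBranch g c k = n} μ := by
    intro k n
    have : {c | leftmostBranch g c k = n} = ⋃ l : List ℕ, {c | leftmostPrefix g c k = l} ∩
          {c | sInf {n | c ∈ branchImage g (k + 1) (l ++ [n])} = n} := by
      ext c
      simp only [Set.mem_iUnion, Set.mem_inter_iff, Set.mem_ofPred_eq, exists_eq_left']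
      rfl
    rw [this]
    exact NullMeasurableSet.iUnion fun l => (hpre k l).inter (key k l n)
  exact @measurable_pi_lambda (NullMeasurableSpace X μ) ℕ (fun _ => ℕ) _ _ _
    fun k => measurable_to_countable' (β := NullMeasurableSpace X μ) fun n => hcoord k n

end Selection

/-- Jankov-von Neumann selection modulo `μ`: parametrize `A` by a continuous `h` on Baire space and
follow `h` along the leftmost branch of `f ∘ h`, which is measurable up to null sets. -/
theorem exists_measurable_section {E X : Type*} [MeasurableSpace E] [StandardBorelSpace E]
    [MeasurableSpace X] [StandardBorelSpace X] [Nonempty E] {f : E → X} (hf : Measurable f)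
    {A : Set E} (hA : MeasurableSet A) (μ : Measure X) [IsFiniteMeasure μ]
    (hμ : ∀ᵐ x ∂μ, x ∈ f '' A) :
    ∃ s : X → E, Measurable s ∧ ∀ᵐ x ∂μ, s x ∈ A ∧ f (s x) = x := by
  let := upgradeStandardBorel X
  let tE := upgradeStandardBorel E
  -- A finer Polish topology makes `f` continuous without changing the Borel sets, so `f ∘ h` is
  -- continuous below.
  obtain ⟨t', ht', hfc, hpol⟩ := hf.exists_continuous
  have hB : @BorelSpace E t' _ := by
    refine @BorelSpace.mk E t' _ ?_
    rw [borel_eq_borel_of_le hpol tE.toPolishSpace ht']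
    exact BorelSpace.measurable_eq
  have hAn := @MeasurableSet.analyticSet E t' hpol _ hB A hA
  rw [@AnalyticSet] at hAn
  rcases hAn with rfl | ⟨h, hh, rfl⟩
  · refine ⟨fun _ => Classical.arbitrary E, measurable_const, ?_⟩
    filter_upwards [hμ] with x hx
    simp at hx
  have hg : Continuous (f ∘ h) := hfc.comp hh
  have hhm : Measurable h := @Continuous.measurable _ _ _ _ _ t' _ hB _ hh
  have ht : AEMeasurable (leftmostBranch (f ∘ h)) μ := by
    refine (nullMeasurable_leftmostBranch (f ∘ h) fun k l => ?_).aemeasurable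
    refine MeasurableSet.nullMeasurableSet_image hg.measurable ?_ μ
    have : ∀ l : List ℕ, MeasurableSet {x : ℕ → ℕ | (List.range k).map x = l} := by
      induction k with
      | zero => exact fun l => MeasurableSet.const ([] = l)
      | succ k ih =>
        intro l
        have : {x : ℕ → ℕ | (List.range (k + 1)).map x = l} =
            ⋃ (p : List ℕ × ℕ) (_ : p.1 ++ [p.2] = l),
              {x | (List.range k).map x = p.1} ∩ {x | x k = p.2} := by
          ext x
          simp only [Set.mem_iUnion, Set.mem_inter_iff, Set.mem_ofPred_eq, exists_prop, Prod.exists,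
            List.range_succ, List.map_append, List.map_cons, List.map_nil]
          constructor
          · exact fun h => ⟨_, _, h, rfl, rfl⟩
          · rintro ⟨a, n, h1, rfl, rfl⟩
            exact h1
        rw [this]
        exact MeasurableSet.iUnion fun p => MeasurableSet.iUnion fun _ =>
          (ih _).inter (measurable_pi_apply k (measurableSet_singleton _))
    exact this l
  refine ⟨h ∘ ht.mk _, hhm.comp ht.measurable_mk, ?_⟩
  filter_upwards [hμ, ht.ae_eq_mk] with x hx hxe
  refine ⟨⟨_, rfl⟩, ?_⟩
  rw [Function.comp_apply, ← hxe]
  refine apply_leftmostBranch (f ∘ h) hg ?_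
  obtain ⟨_, ⟨y, rfl⟩, rfl⟩ := hx
  exact ⟨y, rfl⟩

/-! ### Fiberwise infima and suprema, and optimal lifts -/

section FiberInf

/-- The infimum of `w` over the fibers of `f`. -/
noncomputable def fiberInf {E X : Type*} (f : E → X) (w : E → ℝ≥0∞) (x : X) : ℝ≥0∞ :=
  ⨅ z ∈ f ⁻¹' {x}, w z

theorem fiberInf_le {E X : Type*} (f : E → X) (w : E → ℝ≥0∞) (z : E) :
    fiberInf f w (f z) ≤ w z :=
  biInf_le w (Set.mem_preimage.2 rfl)

variable {E X : Type*} [MeasurableSpace E] [StandardBorelSpace E] [MeasurableSpace X]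
  [StandardBorelSpace X] {f : E → X} {μ : Measure X}

/-- Strict sublevel sets of the fiberwise infimum are images under `f` of measurable sets: analytic,
hence null measurable. -/
theorem aemeasurable_fiberInf [IsFiniteMeasure μ] (hf : Measurable f) {w : E → ℝ≥0∞}
    (hw : Measurable w) : AEMeasurable (fiberInf f w) μ := by
  refine NullMeasurable.aemeasurable ?_
  refine @measurable_of_Iio ℝ≥0∞ (NullMeasurableSpace X μ) _ _ _ _ _ _ _ _ fun c => ?_
  have : fiberInf f w ⁻¹' Set.Iio c = f '' {z | w z < c} := by
    ext x
    simp only [fiberInf, Set.mem_preimage, Set.mem_Iio, iInf_lt_iff, Set.mem_image,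
      Set.mem_ofPred_eq, Set.mem_singleton_iff, exists_prop]
    exact exists_congr fun z => and_comm
  exact this ▸ MeasurableSet.nullMeasurableSet_image hf (hw measurableSet_Iio) μ

theorem aemeasurable_iSup_fiber [IsFiniteMeasure μ] (hf : Measurable f) {w : E → EReal}
    (hw : Measurable w) : AEMeasurable (fun x => ⨆ z ∈ f ⁻¹' {x}, w z) μ := by
  refine NullMeasurable.aemeasurable ?_
  refine @measurable_of_Ioi EReal (NullMeasurableSpace X μ) _ _ _ _ _ _ _ _ fun c => ?_
  have : (fun x => ⨆ z ∈ f ⁻¹' {x}, w z) ⁻¹' Set.Ioi c = f '' {z | c < w z} := by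
    ext x
    simp only [Set.mem_preimage, Set.mem_Ioi, lt_iSup_iff, Set.mem_image,
      Set.mem_ofPred_eq, Set.mem_singleton_iff, exists_prop]
    exact exists_congr fun z => and_comm
  exact this ▸ MeasurableSet.nullMeasurableSet_image hf (hw measurableSet_Ioi) μ

theorem lintegral_fiberInf_le [IsFiniteMeasure μ] (hf : Measurable f) {w : E → ℝ≥0∞}
    (hw : Measurable w) {ν : Measure E} (hν : ν.map f = μ) :
    ∫⁻ x, fiberInf f w x ∂μ ≤ ∫⁻ z, w z ∂ν := by
  rw [← hν, lintegral_map' (by rw [hν]; exact aemeasurable_fiberInf hf hw) hf.aemeasurable]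
  exact lintegral_mono fun z => fiberInf_le f w z

/-- A measurable selection of points that minimize `w` on their fiber up to `ε` pushes `μ` to such a
lift. With `lintegral_fiberInf_le`, integrating the fiberwise infimum amounts to minimizing over
lifts. -/
theorem exists_map_eq_lintegral_le [IsProbabilityMeasure μ] (hf : Measurable f)
    (hsurj : Function.Surjective f) {w : E → ℝ≥0∞} (hw : Measurable w) {ε : ℝ≥0∞} (hε : ε ≠ 0) :
    ∃ ν : Measure E, ν.map f = μ ∧ ∫⁻ z, w z ∂ν ≤ ∫⁻ x, fiberInf f w x ∂μ + ε := by
  obtain ⟨x₀⟩ := nonempty_of_isProbabilityMeasure μ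
  have : Nonempty E := (hsurj x₀).nonempty
  have hF := aemeasurable_fiberInf (μ := μ) hf hw
  -- The infimum is only almost everywhere measurable; a measurable version makes the set of
  -- near-minimizers measurable.
  have hA : MeasurableSet {z | w z ≤ hF.mk _ (f z) + ε} :=
    measurableSet_le hw ((hF.measurable_mk.comp hf).add_const ε)
  obtain ⟨s, hs, hsA⟩ := exists_measurable_section hf hA μ (by
    filter_upwards [hF.ae_eq_mk] with x hx
    rcases eq_or_ne (fiberInf f w x) ⊤ with htop | htop
    · obtain ⟨z, rfl⟩ := hsurj x
      exact ⟨z, by simp [← hx, htop], rfl⟩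
    · have hlt := ENNReal.lt_add_right htop hε
      nth_rw 1 [fiberInf] at hlt
      simp only [iInf_lt_iff] at hlt
      obtain ⟨z, hz, hzlt⟩ := hlt
      obtain rfl : f z = x := hz
      exact ⟨z, by simpa [← hx] using hzlt.le, rfl⟩)
  refine ⟨μ.map s, ?_, ?_⟩
  · rw [Measure.map_map hf hs, Measure.map_congr (f := f ∘ s) (g := id) (hsA.mono fun x hx => hx.2),
      Measure.map_id]
  · rw [lintegral_map hw hs]
    calc ∫⁻ x, w (s x) ∂μ ≤ ∫⁻ x, (fiberInf f w x + ε) ∂μ := by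
          refine lintegral_mono_ae ?_
          filter_upwards [hsA, hF.ae_eq_mk] with x hx hxe
          have : w (s x) ≤ hF.mk _ (f (s x)) + ε := hx.1
          rwa [hx.2, ← hxe] at this
      _ = _ := by rw [lintegral_add_right _ measurable_const]; simp

end FiberInf

/-! ## Kernels of `σ`-Markov operators -/

theorem BddMeas.measurable {Z : Type*} [MeasurableSpace Z] (φ : BddMeas Z) : Measurable φ.1 :=
  φ.2.1

theorem BddMeas.integrable {Z : Type*} [MeasurableSpace Z] (φ : BddMeas Z) (ν : Measure Z)
    [IsFiniteMeasure ν] : Integrable φ.1 ν := by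
  obtain ⟨C, hC⟩ := φ.2.2
  exact Integrable.of_bound (BddMeas.measurable φ).aestronglyMeasurable C (ae_of_all _ hC)

/-- A simple function as an element of `B(Z)`. -/
def BddMeas.ofSimpleFunc {Z : Type*} [MeasurableSpace Z] (s : SimpleFunc Z ℝ) : BddMeas Z :=
  ⟨s, s.measurable, s.exists_forall_norm_le⟩

namespace SigmaMarkov

variable {Z : Type*} [MeasurableSpace Z] (Q : SigmaMarkov Z)

theorem kernel_apply (z : Z) {A : Set Z} (hA : MeasurableSet A) :
    Q.kernel z A = ENNReal.ofReal ((Q.toLin (BddMeas.ind A hA)).1 z) :=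
  Measure.ofMeasurable_apply A hA

instance isProbabilityMeasure_kernel (z : Z) : IsProbabilityMeasure (Q.kernel z) := by
  constructor
  have : BddMeas.ind (Set.univ : Set Z) MeasurableSet.univ = BddMeas.one Z := by
    ext w; simp [BddMeas.ind, BddMeas.one]
  rw [Q.kernel_apply z MeasurableSet.univ, this, Q.map_one]
  simp [BddMeas.one]

theorem measurable_kernel : Measurable Q.kernel := by
  refine Measure.measurable_of_measurable_coe _ fun A hA => ?_
  simp only [Q.kernel_apply _ hA]
  exact (BddMeas.measurable (Q.toLin (BddMeas.ind A hA))).ennreal_ofReal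

theorem toLin_ind_nonneg (z : Z) {A : Set Z} (hA : MeasurableSet A) :
    0 ≤ (Q.toLin (BddMeas.ind A hA)).1 z :=
  Q.nonneg _ (fun w => Set.indicator_nonneg (fun _ _ => zero_le_one) w) z

theorem toLin_ofSimpleFunc (z : Z) (s : SimpleFunc Z ℝ) :
    (Q.toLin (BddMeas.ofSimpleFunc s)).1 z = ∫ w, s w ∂Q.kernel z := by
  induction s using SimpleFunc.induction with
  | const c hA =>
    rename_i A
    have h1 : BddMeas.ofSimpleFunc (SimpleFunc.piecewise A hA (SimpleFunc.const Z c)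
        (SimpleFunc.const Z 0)) = c • BddMeas.ind A hA := by
      ext w
      by_cases hw : w ∈ A <;> simp [BddMeas.ofSimpleFunc, BddMeas.ind, hw]
    have h2 : ∀ w, (SimpleFunc.piecewise A hA (SimpleFunc.const Z c) (SimpleFunc.const Z 0)) w =
        A.indicator (fun _ => c) w := by
      intro w
      by_cases hw : w ∈ A <;> simp [hw]
    rw [h1, map_smul]
    simp only [h2]
    rw [integral_indicator_const _ hA, measureReal_def, Q.kernel_apply z hA,
      ENNReal.toReal_ofReal (Q.toLin_ind_nonneg z hA), smul_eq_mul, mul_comm]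
    rfl
  | @add f g _ hf hg =>
    have h1 : BddMeas.ofSimpleFunc (f + g) = BddMeas.ofSimpleFunc f + BddMeas.ofSimpleFunc g := rfl
    rw [h1, map_add]
    change (Q.toLin (BddMeas.ofSimpleFunc f)).1 z + (Q.toLin (BddMeas.ofSimpleFunc g)).1 z = _
    rw [hf, hg]
    simp only [SimpleFunc.coe_add, Pi.add_apply]
    exact (integral_add (BddMeas.integrable (BddMeas.ofSimpleFunc f) _)
      (BddMeas.integrable (BddMeas.ofSimpleFunc g) _)).symm

theorem exists_simpleFunc_abs_sub_le (φ : BddMeas Z) (n : ℕ) :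
    ∃ s : SimpleFunc Z ℝ, ∀ z, s z ≤ φ.1 z ∧ φ.1 z ≤ s z + 1 / (n + 1) := by
  obtain ⟨C, hC⟩ := φ.2.2
  have hn : (0 : ℝ) < n + 1 := by positivity
  -- `φ` is rounded down to a multiple of `1 / (n + 1)`; boundedness leaves finitely many values.
  have hm : Measurable fun z => ((⌊(n + 1) * φ.1 z⌋ : ℤ) : ℝ) / (n + 1) :=
    ((measurable_from_top (f := fun k : ℤ => (k : ℝ))).comp
      (Int.measurable_floor.comp ((BddMeas.measurable φ).const_mul _))).div_const _
  refine ⟨⟨fun z => ((⌊(n + 1) * φ.1 z⌋ : ℤ) : ℝ) / (n + 1),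
      fun x => hm (measurableSet_singleton x),
    ?_⟩, fun z => ⟨?_, ?_⟩⟩
  · refine ((Set.finite_Icc ⌊-((n + 1) * C)⌋ ⌊(n + 1) * C⌋).image
      fun k : ℤ => (k : ℝ) / (n + 1)).subset ?_
    rintro _ ⟨z, rfl⟩
    have := abs_le.1 (hC z)
    refine ⟨_, ⟨Int.floor_mono ?_, Int.floor_mono ?_⟩, rfl⟩ <;> nlinarith
  · change ((⌊(n + 1) * φ.1 z⌋ : ℤ) : ℝ) / (n + 1) ≤ φ.1 z
    rw [div_le_iff₀ hn, mul_comm]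
    exact Int.floor_le _
  · change φ.1 z ≤ ((⌊(n + 1) * φ.1 z⌋ : ℤ) : ℝ) / (n + 1) + 1 / (n + 1)
    rw [← add_div, le_div_iff₀ hn, mul_comm]
    exact (Int.lt_floor_add_one _).le

/-- Both sides are monotone and agree on simple functions, so squeezing `φ` between `s` and `s + 1 /
(n + 1)` suffices. -/
theorem toLin_eq_integral (φ : BddMeas Z) (z : Z) :
    (Q.toLin φ).1 z = ∫ w, φ.1 w ∂Q.kernel z := by
  have key : ∀ n : ℕ, |(Q.toLin φ).1 z - ∫ w, φ.1 w ∂Q.kernel z| ≤ 1 / ((n : ℝ) + 1) := by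
    intro n
    obtain ⟨s, hs⟩ := exists_simpleFunc_abs_sub_le φ n
    have h1 := Q.mono (φ := BddMeas.ofSimpleFunc s) (ψ := φ) (fun w => (hs w).1) z
    have h2 := Q.mono (φ := φ) (ψ := BddMeas.ofSimpleFunc s + (1 / ((n : ℝ) + 1)) • BddMeas.one Z)
      (fun w => by simpa [BddMeas.one, BddMeas.ofSimpleFunc] using (hs w).2) z
    rw [map_add, map_smul, Q.map_one] at h2
    have h2' : (Q.toLin φ).1 z ≤ (Q.toLin (BddMeas.ofSimpleFunc s)).1 z + 1 / ((n : ℝ) + 1) := by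
      simpa [BddMeas.one] using h2
    rw [toLin_ofSimpleFunc] at h1 h2'
    have hsi : Integrable s (Q.kernel z) := BddMeas.integrable (BddMeas.ofSimpleFunc s) _
    have h3 := integral_mono hsi (BddMeas.integrable φ (Q.kernel z)) (fun w => (hs w).1)
    have h4 := integral_mono (BddMeas.integrable φ (Q.kernel z))
      (hsi.add (integrable_const (1 / ((n : ℝ) + 1))))
      (fun w => (hs w).2)
    simp only [Pi.add_apply] at h4
    rw [integral_add hsi (integrable_const _)] at h4
    simp only [integral_const, probReal_univ, smul_eq_mul, one_mul] at h4
    rw [abs_le]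
    constructor <;> linarith
  have h0 : |(Q.toLin φ).1 z - ∫ w, φ.1 w ∂Q.kernel z| ≤ 0 :=
    ge_of_tendsto' tendsto_one_div_add_atTop_nhds_zero_nat key
  exact sub_eq_zero.1 (abs_nonpos_iff.1 h0)

theorem ofReal_toLin (φ : BddMeas Z) (hφ : ∀ z, 0 ≤ φ.1 z) (z : Z) :
    ENNReal.ofReal ((Q.toLin φ).1 z) = ∫⁻ w, ENNReal.ofReal (φ.1 w) ∂Q.kernel z := by
  rw [toLin_eq_integral, ofReal_integral_eq_lintegral_ofReal (BddMeas.integrable φ _)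
    (ae_of_all _ hφ)]

theorem kernel_iter_zero (z : Z) : (Q.iter 0).kernel z = Measure.dirac z := by
  ext A hA
  rw [kernel_apply _ _ hA, Measure.dirac_apply' _ hA]
  change ENNReal.ofReal (A.indicator (fun _ => 1) z) = _
  by_cases h : z ∈ A <;> simp [h]

theorem kernel_iter_succ (n : ℕ) (z : Z) :
    (Q.iter (n + 1)).kernel z = (Q.kernel z).bind (Q.iter n).kernel := by
  ext A hA
  rw [kernel_apply _ _ hA, Measure.bind_apply hA (Q.iter n).measurable_kernel.aemeasurable]
  change ENNReal.ofReal ((Q.toLin ((Q.iter n).toLin (BddMeas.ind A hA))).1 z) = _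
  rw [ofReal_toLin _ _ fun w => (Q.iter n).toLin_ind_nonneg w hA]
  exact lintegral_congr fun w => ((Q.iter n).kernel_apply w hA).symm

/-- The action of a `σ`-Markov operator on nonnegative functions. -/
noncomputable def act (f : Z → ℝ≥0∞) (z : Z) : ℝ≥0∞ := ∫⁻ w, f w ∂Q.kernel z

theorem measurable_act {f : Z → ℝ≥0∞} (hf : Measurable f) : Measurable (Q.act f) :=
  (Measure.measurable_lintegral hf).comp Q.measurable_kernel

/-- The action of a `σ`-Markov operator on measures. -/
noncomputable def dual (ν : Measure Z) : Measure Z := ν.bind Q.kernel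

theorem lintegral_dual (ν : Measure Z) {f : Z → ℝ≥0∞} (hf : Measurable f) :
    ∫⁻ z, f z ∂Q.dual ν = ∫⁻ z, Q.act f z ∂ν :=
  Measure.lintegral_bind Q.measurable_kernel.aemeasurable hf.aemeasurable

theorem dual_apply (ν : Measure Z) {A : Set Z} (hA : MeasurableSet A) :
    Q.dual ν A = ∫⁻ z, Q.kernel z A ∂ν :=
  Measure.bind_apply hA Q.measurable_kernel.aemeasurable

instance isProbabilityMeasure_dual (ν : Measure Z) [IsProbabilityMeasure ν] :
    IsProbabilityMeasure (Q.dual ν) := by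
  constructor
  rw [dual_apply _ _ MeasurableSet.univ]
  simp

theorem integral_dual (ν : Measure Z) [IsProbabilityMeasure ν] (φ : BddMeas Z) :
    ∫ z, φ.1 z ∂Q.dual ν = ∫ z, (Q.toLin φ).1 z ∂ν := by
  obtain ⟨C, hC⟩ := φ.2.2
  have hpos : ∀ z, 0 ≤ (φ + C • BddMeas.one Z).1 z := fun z => by
    have := (abs_le.1 (hC z)).1
    simp [BddMeas.one]; linarith
  have key : ∫ z, (φ + C • BddMeas.one Z).1 z ∂Q.dual ν =
      ∫ z, (Q.toLin (φ + C • BddMeas.one Z)).1 z ∂ν := by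
    rw [integral_eq_lintegral_of_nonneg_ae (ae_of_all _ hpos)
      (BddMeas.measurable _).aestronglyMeasurable,
      integral_eq_lintegral_of_nonneg_ae (ae_of_all _ (Q.nonneg _ hpos))
      (BddMeas.measurable _).aestronglyMeasurable,
      lintegral_dual _ _ (BddMeas.measurable _).ennreal_ofReal]
    simp only [ofReal_toLin _ _ hpos]
    rfl
  rw [map_add, map_smul, Q.map_one] at key
  have h1 : ∀ (ψ : BddMeas Z) (ν : Measure Z) [IsProbabilityMeasure ν],
      ∫ z, (ψ + C • BddMeas.one Z).1 z ∂ν = ∫ z, ψ.1 z ∂ν + C := by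
    intro ψ ν _
    have : ∀ z, (ψ + C • BddMeas.one Z).1 z = ψ.1 z + C := fun z => by simp [BddMeas.one]
    simp only [this]
    rw [integral_add (BddMeas.integrable ψ ν) (integrable_const _)]
    simp
  rw [h1, h1] at key
  exact add_right_cancel key

theorem dual_iter_zero (ν : Measure Z) : (Q.iter 0).dual ν = ν := by
  ext A hA
  rw [dual_apply _ _ hA]
  simp only [kernel_iter_zero, Measure.dirac_apply' _ hA]
  exact lintegral_indicator_one hA

theorem dual_iter_succ (n : ℕ) (ν : Measure Z) :
    (Q.iter (n + 1)).dual ν = (Q.iter n).dual (Q.dual ν) := by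
  rw [dual, dual, dual, Measure.bind_bind Q.measurable_kernel.aemeasurable
    (Q.iter n).measurable_kernel.aemeasurable]
  congr 1
  exact funext fun z => Q.kernel_iter_succ n z

theorem dual_iter_add (m n : ℕ) (ν : Measure Z) :
    (Q.iter (m + n)).dual ν = (Q.iter m).dual ((Q.iter n).dual ν) := by
  induction n generalizing ν with
  | zero => rw [add_zero, dual_iter_zero]
  | succ n ih => rw [← add_assoc, dual_iter_succ, ih, dual_iter_succ]

theorem mem_invariantMeasures_iff {ν : Measure Z} :
    ν ∈ invariantMeasures Q ↔ IsProbabilityMeasure ν ∧ Q.dual ν = ν := by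
  constructor
  · rintro ⟨h1, h2⟩
    refine ⟨h1, ?_⟩
    ext A hA
    have h := h2 (BddMeas.ind A hA)
    rw [← integral_dual] at h
    change ∫ z, A.indicator (fun _ => (1 : ℝ)) z ∂_ = ∫ z, A.indicator (fun _ => (1 : ℝ)) z ∂_ at h
    rw [integral_indicator_const _ hA, integral_indicator_const _ hA, smul_eq_mul, smul_eq_mul,
      mul_one, mul_one] at h
    exact (measureReal_eq_measureReal_iff).1 h
  · rintro ⟨h1, h2⟩
    refine ⟨h1, fun φ => ?_⟩
    rw [← integral_dual, h2]

theorem dual_iter_of_mem {ν : Measure Z} (hν : ν ∈ invariantMeasures Q) (n : ℕ) :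
    (Q.iter n).dual ν = ν := by
  induction n with
  | zero => exact Q.dual_iter_zero ν
  | succ n ih => rw [dual_iter_succ, (Q.mem_invariantMeasures_iff.1 hν).2, ih]

end SigmaMarkov

/-! ### Passing kernels and measures to the factor -/

section Factor

variable {E X : Type*} [MeasurableSpace E] [MeasurableSpace X] {f : E → X}
  {Qhat : SigmaMarkov E} {Q : SigmaMarkov X}

theorem factor_iter (hf : Measurable f) (h : ∀ φ : BddMeas X,
    Qhat.toLin (BddMeas.pullback f hf φ) = BddMeas.pullback f hf (Q.toLin φ)) (n : ℕ)
    (φ : BddMeas X) :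
    (Qhat.iter n).toLin (BddMeas.pullback f hf φ) =
      BddMeas.pullback f hf ((Q.iter n).toLin φ) := by
  induction n with
  | zero => rfl
  | succ n ih =>
    change Qhat.toLin ((Qhat.iter n).toLin _) = BddMeas.pullback f hf (Q.toLin _)
    rw [ih, h]

theorem map_kernel_of_factor (hf : Measurable f) (h : ∀ φ : BddMeas X,
    Qhat.toLin (BddMeas.pullback f hf φ) = BddMeas.pullback f hf (Q.toLin φ)) (z : E) :
    (Qhat.kernel z).map f = Q.kernel (f z) := by
  ext A hA
  rw [Measure.map_apply hf hA, Qhat.kernel_apply z (hf hA), Q.kernel_apply _ hA]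
  have h1 : BddMeas.ind (f ⁻¹' A) (hf hA) = BddMeas.pullback f hf (BddMeas.ind A hA) := rfl
  rw [h1, h]
  rfl

theorem map_dual_of_factor (hf : Measurable f) (h : ∀ φ : BddMeas X,
    Qhat.toLin (BddMeas.pullback f hf φ) = BddMeas.pullback f hf (Q.toLin φ)) (ν : Measure E) :
    (Qhat.dual ν).map f = Q.dual (ν.map f) := by
  ext A hA
  rw [Measure.map_apply hf hA, SigmaMarkov.dual_apply _ _ (hf hA), SigmaMarkov.dual_apply _ _ hA,
    lintegral_map (f := fun x => Q.kernel x A)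
      ((Measure.measurable_coe hA).comp Q.measurable_kernel) hf]
  refine lintegral_congr fun z => ?_
  rw [← map_kernel_of_factor hf h z, Measure.map_apply hf hA]

end Factor

/-! ## Limits of measures with a fixed projection -/

/-- `O` is the union of the rectangles `A V × V`, with `V` in a countable basis and `A V` the set of
`c` whose section contains `V`. Enlarging each `A V` slightly to an open set gives an open `O' ⊇ O`
whose excess lies over a set of `μ`-measure at most `ε`. The common marginal makes the excess
uniformly small for all `ls n`, and the portmanteau inequality applies to `O'`. -/
theorem measure_le_liminf_of_isOpen_sections {C Y : Type*} [MetricSpace C]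
    [SecondCountableTopology C] [MeasurableSpace C] [BorelSpace C] [StandardBorelSpace C]
    [MetricSpace Y] [SecondCountableTopology Y] [MeasurableSpace Y] [BorelSpace Y]
    [StandardBorelSpace Y] {l : ProbabilityMeasure (C × Y)} {ls : ℕ → ProbabilityMeasure (C × Y)}
    (hlim : Tendsto ls atTop (𝓝 l)) {μ : Measure C} [IsFiniteMeasure μ]
    (hls : ∀ n, (ls n : Measure (C × Y)).map Prod.fst = μ) {O : Set (C × Y)}
    (hO : MeasurableSet O) (hsec : ∀ c, IsOpen {y | (c, y) ∈ O}) :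
    (l : Measure (C × Y)) O ≤ liminf (fun n => (ls n : Measure (C × Y)) O) atTop := by
  refine ENNReal.le_of_forall_pos_le_add fun ε hε _ => ?_
  let B := TopologicalSpace.countableBasis Y
  have hBc : Countable B := (TopologicalSpace.countable_countableBasis Y).to_subtype
  obtain ⟨δ, hδ, hδsum⟩ :=
    ENNReal.exists_pos_sum_of_countable (ENNReal.coe_ne_zero.2 hε.ne') B
  -- Complement of a projection of a Borel set: in general not Borel, but `μ`-measurable.
  let A : B → Set C := fun V => (Prod.fst '' (Oᶜ ∩ Set.univ ×ˢ V.1))ᶜ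
  have hA : ∀ V, NullMeasurableSet (A V) μ := fun V =>
    (MeasurableSet.nullMeasurableSet_image measurable_fst (hO.compl.inter
      (MeasurableSet.univ.prod (TopologicalSpace.isOpen_of_mem_countableBasis V.2).measurableSet))
      μ).compl
  choose A' hAA' hA'o hA'μ using fun V => (A V).exists_isOpen_le_add μ
    (ENNReal.coe_ne_zero.2 (hδ V).ne')
  have hdiff : ∀ V, μ (A' V \ A V) ≤ δ V := fun V => by
    rw [measure_sdiff (hAA' V) (hA V) (measure_ne_top _ _)]
    exact tsub_le_iff_left.2 (hA'μ V)
  let O' : Set (C × Y) := ⋃ V : B, A' V ×ˢ V.1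
  have hO' : IsOpen O' := isOpen_iUnion fun V =>
    (hA'o V).prod (TopologicalSpace.isOpen_of_mem_countableBasis V.2)
  have hsub : O ⊆ O' := by
    rintro ⟨c, y⟩ hcy
    obtain ⟨V, hV, hyV, hVO⟩ :=
      (TopologicalSpace.isBasis_countableBasis Y).exists_subset_of_mem_open
      (show y ∈ {y | (c, y) ∈ O} from hcy) (hsec c)
    refine Set.mem_iUnion.2 ⟨⟨V, hV⟩, hAA' _ ?_, hyV⟩
    rintro ⟨⟨c', y'⟩, ⟨h1, -, h2⟩, rfl⟩
    exact h1 (hVO h2)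
  have hsmall : ∀ n, (ls n : Measure (C × Y)) O' ≤ (ls n : Measure (C × Y)) O + ε := by
    intro n
    have hcov : O' ⊆ O ∪ ⋃ V : B, Prod.fst ⁻¹' (toMeasurable μ (A' V \ A V)) := by
      rintro ⟨c, y⟩ hcy
      obtain ⟨V, hcV, hyV⟩ := Set.mem_iUnion.1 hcy
      by_cases hc : c ∈ A V
      · left
        by_contra hn
        exact hc ⟨(c, y), ⟨hn, trivial, hyV⟩, rfl⟩
      · exact Or.inr (Set.mem_iUnion.2 ⟨V, subset_toMeasurable _ _ ⟨hcV, hc⟩⟩)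
    refine (measure_mono hcov).trans ((measure_union_le _ _).trans ?_)
    refine add_le_add le_rfl ((measure_iUnion_le _).trans ?_)
    refine le_trans (ENNReal.tsum_le_tsum fun V => ?_) hδsum.le
    rw [← Measure.map_apply measurable_fst (measurableSet_toMeasurable _ _), hls,
      measure_toMeasurable]
    exact hdiff V
  calc (l : Measure (C × Y)) O ≤ (l : Measure (C × Y)) O' := measure_mono hsub
    _ ≤ liminf (fun n => (ls n : Measure (C × Y)) O') atTop :=
        ProbabilityMeasure.le_liminf_measure_open_of_tendsto hlim hO'
    _ ≤ liminf (fun n => (ls n : Measure (C × Y)) O + ε) atTop :=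
        liminf_le_liminf (Eventually.of_forall hsmall)
    _ = _ := liminf_add_const _ _ _ (by isBoundedDefault) (by isBoundedDefault)

theorem exists_measurableEmbedding_cantor (X : Type*) [MeasurableSpace X] [StandardBorelSpace X] :
    ∃ κ : X → ℕ → Bool, MeasurableEmbedding κ := by
  obtain ⟨κ, hκ, hinj⟩ := MeasurableSpace.measurable_injection_nat_bool_of_countablySeparated X
  exact ⟨κ, hκ.measurableEmbedding hinj⟩

/-- A measurable embedding of a standard Borel space into the Cantor space. -/
noncomputable def cantorEmbedding (X : Type*) [MeasurableSpace X] [StandardBorelSpace X] :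
    X → ℕ → Bool :=
  (exists_measurableEmbedding_cantor X).choose

theorem measurableEmbedding_cantorEmbedding (X : Type*) [MeasurableSpace X]
    [StandardBorelSpace X] : MeasurableEmbedding (cantorEmbedding X) :=
  (exists_measurableEmbedding_cantor X).choose_spec

namespace CompactFiberBundle

/-! ### Fiberwise open sets and semicontinuity in the compactification -/

section FiberwiseOpen

variable {E X Y : Type*} [MeasurableSpace E] [MeasurableSpace X] [MetricSpace Y]
  [MeasurableSpace Y] (π : CompactFiberBundle E X Y)

/-- The intersection of `O` with every fiber is relatively open. -/
def IsFiberwiseOpen (O : Set E) : Prop :=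
  ∀ x, ∃ V : Set Y, IsOpen V ∧ ∀ z, π.proj z = x → (z ∈ O ↔ (π.chart z).2 ∈ V)

/-- The restriction of `v` to every fiber is lower semicontinuous. -/
def IsFiberwiseLSC (v : E → ℝ≥0∞) : Prop := ∀ t, π.IsFiberwiseOpen {z | t < v z}

theorem isFiberwiseOpen_empty : π.IsFiberwiseOpen ∅ := fun _ => ⟨∅, isOpen_empty, by simp⟩

/-- The embedding of the total space into the compact metrizable space `(ℕ → Bool) × Y` over the
Cantor embedding of the base. -/
noncomputable def compactify [StandardBorelSpace X] (z : E) : (ℕ → Bool) × Y :=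
  (cantorEmbedding X (π.proj z), (π.chart z).2)

theorem measurableEmbedding_compactify [StandardBorelSpace X] :
    MeasurableEmbedding π.compactify := by
  have h : π.compactify = Prod.map (cantorEmbedding X) id ∘ π.chart := by
    ext z : 1
    simp only [compactify, Function.comp_apply, Prod.map, id, π.fst_chart]
  rw [h]
  exact ((measurableEmbedding_cantorEmbedding X).prodMap MeasurableEmbedding.id).comp
    π.measurableEmbedding_chart

/-- Compactness of the sections enters here. The complement of the image of `Oᶜ` is used instead of
the image of `O`: it also contains all points outside the embedded copy of `E`, and so detects mass
that escapes from `E`. -/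
theorem isOpen_section_compl_image [StandardBorelSpace X] {O : Set E} (hO : π.IsFiberwiseOpen O)
    (c : ℕ → Bool) :
    IsOpen {y | (c, y) ∈ (π.compactify '' Oᶜ)ᶜ} := by
  by_cases hc : c ∈ Set.range (cantorEmbedding X)
  · obtain ⟨x, rfl⟩ := hc
    obtain ⟨V, hV, hOV⟩ := hO x
    have : {y | (cantorEmbedding X x, y) ∈ (π.compactify '' Oᶜ)ᶜ} =
        ({y | (x, y) ∈ Set.range π.chart} ∩ Vᶜ)ᶜ := by
      ext y
      simp only [Set.mem_ofPred_eq, Set.mem_compl_iff, not_iff_not]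
      constructor
      · rintro ⟨z, hz, he⟩
        have h1 : π.proj z = x :=
          (measurableEmbedding_cantorEmbedding X).injective (congrArg Prod.fst he)
        have h2 : (π.chart z).2 = y := congrArg Prod.snd he
        refine ⟨⟨z, Prod.ext ((π.fst_chart z).trans h1) h2⟩, fun hy => hz ?_⟩
        rw [hOV z h1, h2]
        exact hy
      · rintro ⟨⟨z, hz⟩, hy⟩
        have h1 : π.proj z = x := by rw [← π.fst_chart, hz]
        refine ⟨z, fun hzO => hy ?_, ?_⟩
        · have := (hOV z h1).1 hzO
          rwa [hz] at this
        · rw [compactify, h1, hz]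
    rw [this]
    exact ((π.isCompact_section x).isClosed.inter hV.isClosed_compl).isOpen_compl
  · convert! isOpen_univ
    ext y
    simp only [Set.mem_compl_iff, Set.mem_ofPred_eq, Set.mem_univ, iff_true]
    rintro ⟨z, -, hz⟩
    exact hc ⟨π.proj z, congrArg Prod.fst hz⟩

/-- Layer-cake formula for the truncations `min v N`, Fatou's lemma in the level `t`, then monotone
convergence in `N`. -/
theorem IsFiberwiseLSC.lintegral_le_liminf {π : CompactFiberBundle E X Y} {v : E → ℝ≥0∞}
    (hv : π.IsFiberwiseLSC v) (hvm : Measurable v) {m : Measure E} {ν : ℕ → Measure E}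
    (h : ∀ O, MeasurableSet O → π.IsFiberwiseOpen O → m O ≤ liminf (fun n => ν n O) atTop) :
    ∫⁻ z, v z ∂m ≤ liminf (fun n => ∫⁻ z, v z ∂ν n) atTop := by
  have hsup : ∀ z, v z = ⨆ N : ℕ, min (v z) N := fun z => by
    rw [← inf_iSup_eq, ENNReal.iSup_natCast, inf_top_eq]
  have key : ∀ N : ℕ, ∫⁻ z, min (v z) N ∂m ≤ liminf (fun n => ∫⁻ z, min (v z) N ∂ν n) atTop := by
    intro N
    have hne : ∀ z, min (v z) N ≠ ⊤ := fun z => ne_top_of_le_ne_top (ENNReal.natCast_ne_top N)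
      (min_le_right _ _)
    have hlayer : ∀ ρ : Measure E, ∫⁻ z, min (v z) N ∂ρ =
        ∫⁻ t in Set.Ioi (0 : ℝ), ρ {z | t < (min (v z) N).toReal} := by
      intro ρ
      rw [← lintegral_eq_lintegral_meas_lt ρ (ae_of_all _ fun _ => ENNReal.toReal_nonneg)
        (hvm.min measurable_const).ennreal_toReal.aemeasurable]
      exact lintegral_congr fun z => (ENNReal.ofReal_toReal (hne z)).symm
    simp only [hlayer]
    refine le_trans (setLIntegral_mono' measurableSet_Ioi fun t ht => ?_)
      (lintegral_liminf_le (f := fun n (t : ℝ) => ν n {z | t < (min (v z) N).toReal}) fun n =>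
        Antitone.measurable fun s t hst => measure_mono fun z hz => lt_of_le_of_lt hst hz)
    have hset : {z | t < (min (v z) N).toReal} =
        {z | ENNReal.ofReal t < v z} ∩ {z | ENNReal.ofReal t < N} := by
      ext z
      simp only [Set.mem_inter_iff, Set.mem_ofPred_eq]
      rw [← ENNReal.ofReal_lt_iff_lt_toReal (le_of_lt ht) (hne z), lt_min_iff]
    rw [hset]
    by_cases hN : ENNReal.ofReal t < N
    · simp only [hN, Set.ofPred_true, Set.inter_univ]
      exact h _ (measurableSet_lt measurable_const hvm) (hv _)
    · simp [hN]
  rw [lintegral_congr hsup, lintegral_iSup (fun N => hvm.min measurable_const)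
    (fun a b hab z => min_le_min le_rfl (by exact_mod_cast hab))]
  exact iSup_le fun N => (key N).trans (liminf_le_liminf (Eventually.of_forall fun n =>
    lintegral_mono fun z => min_le_left _ _))

end FiberwiseOpen

variable {E X Y : Type*} [MeasurableSpace E] [MeasurableSpace X]
  [StandardBorelSpace X] [MetricSpace Y] [CompactSpace Y] [MeasurableSpace Y] [BorelSpace Y]
  (π : CompactFiberBundle E X Y)

/-- Weak limits exist in the compactification. The limit lives on the image of `E`, so it can be
pulled back, and its marginal is that of the sequence. -/
theorem exists_subseq_limit {μ : Measure X} [IsProbabilityMeasure μ] {ν : ℕ → Measure E}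
    (hν : ∀ n, (ν n).map π.proj = μ) :
    ∃ m : Measure E, m.map π.proj = μ ∧ ∃ φ : ℕ → ℕ, StrictMono φ ∧
      (∀ f : C((ℕ → Bool) × Y, ℝ), Tendsto (fun n => ∫ z, f (π.compactify z) ∂ν (φ n)) atTop
        (𝓝 (∫ z, f (π.compactify z) ∂m))) ∧
      ∀ O, MeasurableSet O → π.IsFiberwiseOpen O → m O ≤ liminf (fun n => ν (φ n) O) atTop := by
  have hj := π.measurableEmbedding_compactify
  have hprob : ∀ n, IsProbabilityMeasure (ν n) := fun n =>
    (Measure.isProbabilityMeasure_map_iff π.measurable_proj.aemeasurable).1 (by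
      rw [hν n]; infer_instance)
  let ls : ℕ → ProbabilityMeasure ((ℕ → Bool) × Y) := fun n =>
    ⟨(ν n).map π.compactify, Measure.isProbabilityMeasure_map hj.measurable.aemeasurable⟩
  have hls : ∀ n, (ls n : Measure ((ℕ → Bool) × Y)).map Prod.fst = μ.map (cantorEmbedding X) := by
    intro n
    change ((ν n).map π.compactify).map Prod.fst = _
    rw [Measure.map_map measurable_fst hj.measurable, ← hν n,
      Measure.map_map (measurableEmbedding_cantorEmbedding X).measurable π.measurable_proj]
    rfl
  obtain ⟨l, -, φ, hφ, hlim⟩ := isCompact_univ.tendsto_subseq (x := ls) fun n => Set.mem_univ _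
  have hopen : ∀ O, MeasurableSet O → π.IsFiberwiseOpen O →
      (l : Measure ((ℕ → Bool) × Y)) (π.compactify '' Oᶜ)ᶜ ≤
        liminf (fun n => ν (φ n) O) atTop := by
    intro O hO hOo
    have hm : MeasurableSet (π.compactify '' Oᶜ)ᶜ := (hj.measurableSet_image.2 hO.compl).compl
    let := TopologicalSpace.metrizableSpaceMetric (ℕ → Bool)
    refine (measure_le_liminf_of_isOpen_sections hlim (fun n => hls (φ n)) hm
      (π.isOpen_section_compl_image hOo)).trans (le_of_eq ?_)
    congr 1
    ext n
    change ((ν (φ n)).map π.compactify) _ = _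
    rw [hj.map_apply, Set.preimage_compl, hj.injective.preimage_image, compl_compl]
  -- This is the inequality for `O = ∅`, whose counterpart is the complement of the range.
  have hrange : (l : Measure ((ℕ → Bool) × Y)) (Set.range π.compactify)ᶜ = 0 := by
    have := hopen ∅ MeasurableSet.empty π.isFiberwiseOpen_empty
    simpa using this
  have hmap : ((l : Measure ((ℕ → Bool) × Y)).comap π.compactify).map π.compactify = l := by
    rw [hj.map_comap, Measure.restrict_eq_self_of_ae_mem]
    exact measure_eq_zero_iff_ae_notMem.1 hrange |>.mono fun _ h => not_not.1 h
  refine ⟨(l : Measure ((ℕ → Bool) × Y)).comap π.compactify, ?_, φ, hφ, ?_, ?_⟩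
  · have h1 : (((l : Measure ((ℕ → Bool) × Y)).comap π.compactify).map π.proj).map
        (cantorEmbedding X) = μ.map (cantorEmbedding X) := by
      rw [Measure.map_map (measurableEmbedding_cantorEmbedding X).measurable π.measurable_proj]
      change Measure.map (Prod.fst ∘ π.compactify) _ = _
      rw [← Measure.map_map measurable_fst hj.measurable, hmap]
      have hfst : Tendsto (fun n => (ls (φ n)).map (f := Prod.fst) measurable_fst.aemeasurable)
          atTop (𝓝 (l.map (f := Prod.fst) measurable_fst.aemeasurable)) :=
        ProbabilityMeasure.tendsto_map_of_tendsto_of_continuous _ _ hlim continuous_fst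
      have hc : ∀ n, (ls (φ n)).map (f := Prod.fst) measurable_fst.aemeasurable =
          (ls (φ 0)).map (f := Prod.fst) measurable_fst.aemeasurable := fun n =>
        Subtype.ext ((hls (φ n)).trans (hls (φ 0)).symm)
      have he := tendsto_nhds_unique hfst ((tendsto_congr hc).2 tendsto_const_nhds)
      exact (congrArg Subtype.val he).trans (hls (φ 0))
    rw [← (measurableEmbedding_cantorEmbedding X).comap_map μ, ← h1,
      (measurableEmbedding_cantorEmbedding X).comap_map]
  · intro f
    have h1 := ProbabilityMeasure.tendsto_iff_forall_integral_tendsto.1 hlim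
      (BoundedContinuousFunction.mkOfCompact f)
    have h2 : ∀ m : Measure E, ∫ z, f (π.compactify z) ∂m = ∫ w, f w ∂m.map π.compactify :=
      fun m => (hj.integral_map _).symm
    simp only [h2, hmap]
    exact h1
  · intro O hO hOo
    rw [hj.comap_apply]
    refine (measure_mono ?_).trans (hopen O hO hOo)
    rintro _ ⟨z, hz, rfl⟩ ⟨z', hz', he⟩
    exact hz' (hj.injective he ▸ hz)

end CompactFiberBundle

/-! ## Invariance of limits -/

namespace CompactFiberBundle

/-! ### Convergence of integrals of functions continuous on sublevel sets -/

section ContinuousOn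

variable {E X Y : Type*} [MeasurableSpace E] [MeasurableSpace X] [MetricSpace Y]
  [MeasurableSpace Y] (π : CompactFiberBundle E X Y)

/-- The restriction of `g` to the intersection of `S` with every fiber is continuous. -/
def IsFiberwiseContinuousOn (g : E → ℝ) (S : Set E) : Prop :=
  ∀ x, ∀ T : Set ℝ, IsOpen T → ∃ V : Set Y, IsOpen V ∧
    ∀ z, π.proj z = x → z ∈ S → (g z ∈ T ↔ (π.chart z).2 ∈ V)

variable {π}

theorem IsFiberwiseContinuousOn.neg {g : E → ℝ} {S : Set E} (hg : π.IsFiberwiseContinuousOn g S) :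
    π.IsFiberwiseContinuousOn (fun z => -g z) S := fun x T hT =>
  hg x (Neg.neg ⁻¹' T) (hT.preimage continuous_neg)

theorem FiberwiseContinuousOff.isFiberwiseContinuousOn {g : E → ℝ} {K S : Set E}
    (hg : π.FiberwiseContinuousOff K g) (hS : Disjoint S K) : π.IsFiberwiseContinuousOn g S := by
  intro x T hT
  obtain ⟨u, hu, hue⟩ := (@continuousOn_iff' E ℝ π.fiberTopology _ g _).1 (hg x) T hT
  obtain ⟨V, hV, rfl⟩ := isOpen_induced_iff.1 hu
  refine ⟨V, hV, fun z hz hzS => ?_⟩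
  have hzmem : z ∈ π.proj ⁻¹' {x} \ K := ⟨hz, Set.disjoint_left.1 hS hzS⟩
  have := Set.ext_iff.1 hue z
  simp only [Set.mem_inter_iff, hzmem, and_true] at this
  exact this

theorem isProbabilityMeasure_of_map_proj {μ : Measure X} [IsProbabilityMeasure μ] {ν : Measure E}
    (hν : ν.map π.proj = μ) : IsProbabilityMeasure ν :=
  (Measure.isProbabilityMeasure_map_iff π.measurable_proj.aemeasurable).1 (by
    rw [hν]; infer_instance)

/-- The function equal to `B + g` on a sublevel set of `v` and to the upper bound `2 B` off it. -/
theorem IsFiberwiseLSC.ite {v : E → ℝ≥0∞} (hv : π.IsFiberwiseLSC v) {g : E → ℝ} {B : ℝ}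
    (hgB : ∀ z, g z ≤ B) {c : ℝ≥0∞} (hg : π.IsFiberwiseContinuousOn g {z | v z ≤ c}) :
    π.IsFiberwiseLSC (fun z => open Classical in
      if v z ≤ c then ENNReal.ofReal (B + g z) else ENNReal.ofReal (2 * B)) := by
  intro t x
  rcases le_or_gt (ENNReal.ofReal (2 * B)) t with ht | ht
  · refine ⟨∅, isOpen_empty, fun z _ => ?_⟩
    simp only [Set.mem_ofPred_eq, Set.mem_empty_iff_false, iff_false, not_lt]
    split_ifs
    · exact (ENNReal.ofReal_le_ofReal (by linarith [hgB z])).trans ht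
    · exact ht
  · obtain ⟨V₁, hV₁, h₁⟩ := hv c x
    obtain ⟨V₂, hV₂, h₂⟩ := hg x {r | t < ENNReal.ofReal (B + r)}
      (isOpen_lt continuous_const (ENNReal.continuous_ofReal.comp (continuous_const.add
        continuous_id)))
    refine ⟨V₁ ∪ V₂, hV₁.union hV₂, fun z hz => ?_⟩
    have h1 := h₁ z hz
    simp only [Set.mem_ofPred_eq] at h1 ⊢
    by_cases hc : v z ≤ c
    · have h2 := h₂ z hz hc
      simp only [Set.mem_ofPred_eq] at h2
      rw [if_pos hc, h2, Set.mem_union, ← h1]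
      simp [hc.not_gt]
    · rw [if_neg hc, Set.mem_union, ← h1]
      exact ⟨fun _ => Or.inl (not_le.1 hc), fun _ => ht⟩

/-- Replacing `B + g` by its upper bound `2 B` where `v > N + 1` produces a fiberwise lower
semicontinuous `u`. Since `u ≤ B + g + 2 B v / (N + 1)`, the bound on `∫ v` makes the error at most
`2 B c₀ / (N + 1)`, uniformly in `n`. -/
theorem lintegral_le_liminf_of_isFiberwiseContinuousOn {v : E → ℝ≥0∞} (hv : π.IsFiberwiseLSC v)
    (hvm : Measurable v) {g : E → ℝ} (hgm : Measurable g) {B : ℝ} (hgB : ∀ z, |g z| ≤ B)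
    (hg : ∀ c : ℝ≥0, π.IsFiberwiseContinuousOn g {z | v z ≤ c}) {m : Measure E}
    {ν : ℕ → Measure E}
    (h : ∀ O, MeasurableSet O → π.IsFiberwiseOpen O → m O ≤ liminf (fun n => ν n O) atTop)
    {c₀ : ℝ≥0∞} (hc₀ : c₀ ≠ ⊤) (hbd : ∀ n, ∫⁻ z, v z ∂ν n ≤ c₀) :
    ∫⁻ z, ENNReal.ofReal (B + g z) ∂m ≤
      liminf (fun n => ∫⁻ z, ENNReal.ofReal (B + g z) ∂ν n) atTop := by
  classical
  have key : ∀ N : ℕ, ∫⁻ z, ENNReal.ofReal (B + g z) ∂m ≤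
      liminf (fun n => ∫⁻ z, ENNReal.ofReal (B + g z) ∂ν n) atTop +
        ENNReal.ofReal (2 * B) * c₀ * ((N + 1 : ℕ) : ℝ≥0∞)⁻¹ := by
    intro N
    let u : E → ℝ≥0∞ := fun z =>
      if v z ≤ ((N + 1 : ℕ) : ℝ≥0) then ENNReal.ofReal (B + g z) else ENNReal.ofReal (2 * B)
    have hu : π.IsFiberwiseLSC u := hv.ite (fun z => (abs_le.1 (hgB z)).2) (hg _)
    have hum : Measurable u := Measurable.ite (measurableSet_le hvm measurable_const)
      (hgm.const_add B).ennreal_ofReal measurable_const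
    have h1 : ∀ z, ENNReal.ofReal (B + g z) ≤ u z := fun z => by
      simp only [u]
      split_ifs
      · exact le_rfl
      · exact ENNReal.ofReal_le_ofReal (by linarith [(abs_le.1 (hgB z)).2])
    have h2 : ∀ z, u z ≤ ENNReal.ofReal (B + g z) +
        ENNReal.ofReal (2 * B) * ((N + 1 : ℕ) : ℝ≥0∞)⁻¹ * v z := fun z => by
      simp only [u]
      split_ifs with hz
      · exact le_self_add
      · refine le_trans ?_ le_add_self
        rw [mul_assoc]
        refine le_mul_of_one_le_right' ?_
        rw [← ENNReal.div_eq_inv_mul, ENNReal.le_div_iff_mul_le (by simp) (by simp), one_mul]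
        exact (not_le.1 hz).le.trans' (by simp)
    have h3 : ∀ n, ∫⁻ z, u z ∂ν n ≤ ∫⁻ z, ENNReal.ofReal (B + g z) ∂ν n +
        ENNReal.ofReal (2 * B) * c₀ * ((N + 1 : ℕ) : ℝ≥0∞)⁻¹ := by
      intro n
      refine (lintegral_mono h2).trans ?_
      rw [lintegral_add_left (hgm.const_add B).ennreal_ofReal, lintegral_const_mul _ hvm,
        mul_right_comm]
      gcongr
      exact hbd n
    calc _ ≤ ∫⁻ z, u z ∂m := lintegral_mono h1
      _ ≤ liminf (fun n => ∫⁻ z, u z ∂ν n) atTop := hu.lintegral_le_liminf hum h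
      _ ≤ liminf (fun n => ∫⁻ z, ENNReal.ofReal (B + g z) ∂ν n +
          ENNReal.ofReal (2 * B) * c₀ * ((N + 1 : ℕ) : ℝ≥0∞)⁻¹) atTop :=
          liminf_le_liminf (Eventually.of_forall h3)
      _ = _ := liminf_add_const _ _ _ (by isBoundedDefault) (by isBoundedDefault)
  have hlim : Tendsto (fun N : ℕ => liminf (fun n => ∫⁻ z, ENNReal.ofReal (B + g z) ∂ν n) atTop +
        ENNReal.ofReal (2 * B) * c₀ * ((N + 1 : ℕ) : ℝ≥0∞)⁻¹) atTop
      (𝓝 (liminf (fun n => ∫⁻ z, ENNReal.ofReal (B + g z) ∂ν n) atTop +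
        ENNReal.ofReal (2 * B) * c₀ * 0)) :=
    tendsto_const_nhds.add (ENNReal.Tendsto.const_mul
      (ENNReal.tendsto_inv_nat_nhds_zero.comp (tendsto_add_atTop_nat 1))
      (Or.inr (ENNReal.mul_ne_top ENNReal.ofReal_ne_top hc₀)))
  rw [mul_zero, add_zero] at hlim
  exact ge_of_tendsto' hlim key

theorem eventually_lt_integral_of_isFiberwiseContinuousOn {v : E → ℝ≥0∞}
    (hv : π.IsFiberwiseLSC v) (hvm : Measurable v) {g : BddMeas E}
    (hg : ∀ c : ℝ≥0, π.IsFiberwiseContinuousOn g.1 {z | v z ≤ c}) {m : Measure E}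
    [IsProbabilityMeasure m] {ν : ℕ → Measure E} [∀ n, IsProbabilityMeasure (ν n)]
    (h : ∀ O, MeasurableSet O → π.IsFiberwiseOpen O → m O ≤ liminf (fun n => ν n O) atTop)
    {c₀ : ℝ≥0∞} (hc₀ : c₀ ≠ ⊤) (hbd : ∀ n, ∫⁻ z, v z ∂ν n ≤ c₀) {a : ℝ}
    (ha : a < ∫ z, g.1 z ∂m) : ∀ᶠ n in atTop, a < ∫ z, g.1 z ∂ν n := by
  obtain ⟨C, hC⟩ := g.2.2
  obtain ⟨z₀⟩ := nonempty_of_isProbabilityMeasure m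
  have hC0 : 0 ≤ C := (abs_nonneg _).trans (hC z₀)
  -- The shift `C + 1`, instead of `C`, keeps the integral strictly positive, so strict inequalities
  -- survive `ENNReal.ofReal`.
  have hrepr : ∀ ρ : Measure E, IsProbabilityMeasure ρ →
      ∫⁻ z, ENNReal.ofReal (C + 1 + g.1 z) ∂ρ = ENNReal.ofReal (C + 1 + ∫ z, g.1 z ∂ρ) := by
    intro ρ _
    rw [← ofReal_integral_eq_lintegral_ofReal (f := fun z => C + 1 + g.1 z)
      ((integrable_const _).add (BddMeas.integrable g ρ)) (ae_of_all _ fun z => by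
        have := (abs_le.1 (hC z)).1
        change 0 ≤ C + 1 + g.1 z; linarith),
      integral_add (integrable_const _) (BddMeas.integrable g ρ)]
    simp
  have hlow : -C ≤ ∫ z, g.1 z ∂m := by
    have := integral_mono (integrable_const (-C)) (BddMeas.integrable g m)
      (fun z => (abs_le.1 (hC z)).1)
    simpa using this
  have key := lintegral_le_liminf_of_isFiberwiseContinuousOn hv hvm (BddMeas.measurable g)
    (B := C + 1) (fun z => (hC z).trans (by linarith)) hg h hc₀ hbd
  rw [hrepr m inferInstance] at key
  have hlt : ENNReal.ofReal (C + 1 + a) < ENNReal.ofReal (C + 1 + ∫ z, g.1 z ∂m) :=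
    (ENNReal.ofReal_lt_ofReal_iff (by linarith)).2 (by linarith)
  filter_upwards [eventually_lt_of_lt_liminf (hlt.trans_le key)] with n hn
  rw [hrepr (ν n) inferInstance, ENNReal.ofReal_lt_ofReal_iff'] at hn
  linarith [hn.1]

theorem tendsto_integral_of_isFiberwiseContinuousOn {v : E → ℝ≥0∞}
    (hv : π.IsFiberwiseLSC v) (hvm : Measurable v) {g : BddMeas E}
    (hg : ∀ c : ℝ≥0, π.IsFiberwiseContinuousOn g.1 {z | v z ≤ c}) {m : Measure E}
    [IsProbabilityMeasure m] {ν : ℕ → Measure E} [∀ n, IsProbabilityMeasure (ν n)]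
    (h : ∀ O, MeasurableSet O → π.IsFiberwiseOpen O → m O ≤ liminf (fun n => ν n O) atTop)
    {c₀ : ℝ≥0∞} (hc₀ : c₀ ≠ ⊤) (hbd : ∀ n, ∫⁻ z, v z ∂ν n ≤ c₀) :
    Tendsto (fun n => ∫ z, g.1 z ∂ν n) atTop (𝓝 (∫ z, g.1 z ∂m)) := by
  refine tendsto_order.2 ⟨fun a ha =>
    eventually_lt_integral_of_isFiberwiseContinuousOn hv hvm hg h hc₀ hbd ha, fun a ha => ?_⟩
  have hneg : ∀ ρ : Measure E, ∫ z, (-g).1 z ∂ρ = -∫ z, g.1 z ∂ρ := fun ρ => integral_neg _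
  filter_upwards [eventually_lt_integral_of_isFiberwiseContinuousOn (g := -g) hv hvm
    (fun c => (hg c).neg) h hc₀ hbd (a := -a) (by rw [hneg]; linarith)] with n hn
  rw [hneg] at hn
  linarith

end ContinuousOn

/-! ### Test functions and invariance of the limit -/

section TestFunctions

variable {E X Y : Type*} [MeasurableSpace E] [MeasurableSpace X]
  [StandardBorelSpace X] [MetricSpace Y] [CompactSpace Y] [MeasurableSpace Y] [BorelSpace Y]
  (π : CompactFiberBundle E X Y)

/-- The pullback to `E` of a continuous function on the compactification. -/
noncomputable def testFun (f : C((ℕ → Bool) × Y, ℝ)) : BddMeas E :=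
  ⟨fun z => f (π.compactify z),
    f.continuous.measurable.comp π.measurableEmbedding_compactify.measurable,
    ‖f‖, fun _ => f.norm_coe_le_norm _⟩

theorem fiberwiseContinuous_testFun (f : C((ℕ → Bool) × Y, ℝ)) :
    π.FiberwiseContinuous (π.testFun f).1 := by
  intro x
  let := π.fiberTopology
  have hc : Continuous fun z : E => f (cantorEmbedding X x, (π.chart z).2) :=
    f.continuous.comp (continuous_const.prodMk continuous_induced_dom)
  refine hc.continuousOn.congr fun z hz => ?_
  have hz' : π.proj z = x := hz
  simp only [testFun, compactify, hz']

variable {π}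

/-- A dense sequence of test functions. -/
noncomputable def denseTestFun (Y : Type*) [MetricSpace Y] [CompactSpace Y] (i : ℕ) :
    C((ℕ → Bool) × Y, ℝ) :=
  TopologicalSpace.denseSeq _ i

/-- The integral is 1-Lipschitz in the test function, so a dense sequence decides all continuous
functions on the compactification. -/
theorem measure_eq_of_integral_denseTestFun {m m' : Measure E} [IsProbabilityMeasure m]
    [IsProbabilityMeasure m'] (h : ∀ i, ∫ z, (π.testFun (denseTestFun Y i)).1 z ∂m =
      ∫ z, (π.testFun (denseTestFun Y i)).1 z ∂m') : m = m' := by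
  have hj := π.measurableEmbedding_compactify
  have hall : ∀ f : C((ℕ → Bool) × Y, ℝ), ∫ z, (π.testFun f).1 z ∂m =
      ∫ z, (π.testFun f).1 z ∂m' := by
    intro f
    have hcl : ∀ (ρ : Measure E) [IsProbabilityMeasure ρ],
        Continuous fun f : C((ℕ → Bool) × Y, ℝ) => ∫ z, (π.testFun f).1 z ∂ρ := by
      intro ρ _
      refine LipschitzWith.continuous (K := 1) (LipschitzWith.of_dist_le_mul fun f g => ?_)
      rw [dist_eq_norm, ← integral_sub (BddMeas.integrable _ ρ) (BddMeas.integrable _ ρ)]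
      refine (norm_integral_le_of_norm_le_const (C := dist f g) (ae_of_all _ fun z => ?_)).trans
        (by simp)
      rw [← dist_eq_norm]
      exact ContinuousMap.dist_apply_le_dist _
    have := (TopologicalSpace.denseRange_denseSeq C((ℕ → Bool) × Y, ℝ)).equalizer
      (hcl m) (hcl m') (funext h)
    exact congrFun this f
  have hmap : m.map π.compactify = m'.map π.compactify := by
    have := Measure.isProbabilityMeasure_map (μ := m) hj.measurable.aemeasurable
    have := Measure.isProbabilityMeasure_map (μ := m') hj.measurable.aemeasurable
    refine ext_of_forall_integral_eq_of_IsFiniteMeasure fun f => ?_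
    rw [hj.integral_map, hj.integral_map]
    exact hall f.toContinuousMap
  rw [← hj.comap_map m, hmap, hj.comap_map]

variable (π)

/-- The operator maps the test functions to functions that are fiberwise continuous on the
sublevel sets of `v`. -/
def IsAdapted (Phat : SigmaMarkov E) (v : E → ℝ≥0∞) : Prop :=
  ∀ i, ∀ c : ℝ≥0, π.IsFiberwiseContinuousOn (Phat.toLin (π.testFun (denseTestFun Y i))).1
    {z | v z ≤ c}

variable {π}

/-- For a test function `f` in the dense sequence, both `∫ f` and `∫ Phat f` pass to the limit, the
latter because `∫ v` is bounded. Their difference tends to zero by hypothesis. -/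
theorem exists_limit_mem_invariantLifts {Phat : SigmaMarkov E} {v : E → ℝ≥0∞}
    (hv : π.IsFiberwiseLSC v) (hvm : Measurable v) (hvP : π.IsAdapted Phat v) {μ : Measure X}
    [IsProbabilityMeasure μ] {ν : ℕ → Measure E} (hν : ∀ n, (ν n).map π.proj = μ) {c₀ : ℝ≥0∞}
    (hc₀ : c₀ ≠ ⊤) (hbd : ∀ n, ∫⁻ z, v z ∂ν n ≤ c₀)
    (hinv : ∀ ψ : BddMeas E,
      Tendsto (fun n => ∫ z, (Phat.toLin ψ).1 z ∂ν n - ∫ z, ψ.1 z ∂ν n) atTop (𝓝 0)) :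
    ∃ m ∈ π.invariantLifts Phat μ, ∃ φ : ℕ → ℕ, StrictMono φ ∧
      (∀ f : C((ℕ → Bool) × Y, ℝ), Tendsto (fun n => ∫ z, (π.testFun f).1 z ∂ν (φ n)) atTop
        (𝓝 (∫ z, (π.testFun f).1 z ∂m))) ∧
      ∫⁻ z, v z ∂m ≤ liminf (fun n => ∫⁻ z, v z ∂ν (φ n)) atTop := by
  obtain ⟨m, hm, φ, hφ, hlim, hopen⟩ := π.exists_subseq_limit hν
  have hmp := isProbabilityMeasure_of_map_proj hm
  have hνp := fun n => isProbabilityMeasure_of_map_proj (hν n)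
  refine ⟨m, ⟨Phat.mem_invariantMeasures_iff.2 ⟨hmp, ?_⟩, hm⟩, φ, hφ, hlim,
    hv.lintegral_le_liminf hvm hopen⟩
  refine measure_eq_of_integral_denseTestFun (π := π) fun i => ?_
  rw [Phat.integral_dual]
  have h1 := tendsto_integral_of_isFiberwiseContinuousOn hv hvm (hvP i) hopen hc₀
    (fun n => hbd (φ n))
  have h2 := (hinv (π.testFun (denseTestFun Y i))).comp hφ.tendsto_atTop
  have h3 := h1.sub (hlim (denseTestFun Y i))
  exact sub_eq_zero.1 (tendsto_nhds_unique h3 h2)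

end TestFunctions

end CompactFiberBundle

/-! ## Existence of invariant lifts and of extreme points -/

namespace SigmaMarkov

variable {Z : Type*} [MeasurableSpace Z] (Q : SigmaMarkov Z)

/-- The average of the first `n` iterated images of a measure. -/
noncomputable def average (n : ℕ) (ν : Measure Z) : Measure Z :=
  (n : ℝ≥0∞)⁻¹ • ∑ k ∈ Finset.range n, (Q.iter k).dual ν

theorem dual_dual_iter (k : ℕ) (ν : Measure Z) :
    Q.dual ((Q.iter k).dual ν) = (Q.iter (k + 1)).dual ν := by
  rw [add_comm, dual_iter_add, dual_iter_succ, dual_iter_zero]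

theorem lintegral_average (n : ℕ) (ν : Measure Z) (f : Z → ℝ≥0∞) :
    ∫⁻ z, f z ∂Q.average n ν =
      (n : ℝ≥0∞)⁻¹ * ∑ k ∈ Finset.range n, ∫⁻ z, f z ∂(Q.iter k).dual ν := by
  rw [average, lintegral_smul_measure, lintegral_finsetSum_measure, smul_eq_mul]

theorem integral_average (n : ℕ) (ν : Measure Z) [IsProbabilityMeasure ν] (φ : BddMeas Z) :
    ∫ z, φ.1 z ∂Q.average n ν =
      (n : ℝ)⁻¹ * ∑ k ∈ Finset.range n, ∫ z, φ.1 z ∂(Q.iter k).dual ν := by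
  rw [average, integral_smul_measure,
    integral_finsetSum_measure fun k _ => BddMeas.integrable φ _]
  simp

theorem integral_toLin_average_sub (n : ℕ) (ν : Measure Z) [IsProbabilityMeasure ν]
    (φ : BddMeas Z) :
    ∫ z, (Q.toLin φ).1 z ∂Q.average n ν - ∫ z, φ.1 z ∂Q.average n ν =
      (n : ℝ)⁻¹ * (∫ z, φ.1 z ∂(Q.iter n).dual ν - ∫ z, φ.1 z ∂ν) := by
  rw [integral_average, integral_average, ← mul_sub, ← Finset.sum_sub_distrib]
  simp only [← integral_dual, dual_dual_iter]
  rw [Finset.sum_range_sub (fun k => ∫ z, φ.1 z ∂(Q.iter k).dual ν), dual_iter_zero]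

end SigmaMarkov

namespace CompactFiberBundle

variable {E X Y : Type*} [MeasurableSpace E] [MeasurableSpace X]
  [StandardBorelSpace X] [MetricSpace Y] [CompactSpace Y] [MeasurableSpace Y] [BorelSpace Y]
  {π : CompactFiberBundle E X Y} {Phat : SigmaMarkov E} {μ : Measure X} {v : E → ℝ≥0∞}

/-- Krylov-Bogoliubov: average the lift given for `n` steps over those steps. The slack `1` becomes
`1 / n`, and the defect of invariance telescopes to `O(1 / n)`. -/
theorem exists_mem_invariantLifts_lintegral_le [IsProbabilityMeasure μ]
    (hv : π.IsFiberwiseLSC v) (hvm : Measurable v) (hvP : π.IsAdapted Phat v)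
    (hdual : ∀ n, ∀ ν : Measure E, ν.map π.proj = μ → ((Phat.iter n).dual ν).map π.proj = μ)
    {S : ℝ≥0∞} (hS : S ≠ ⊤)
    (h : ∀ n : ℕ, 1 ≤ n → ∃ ν : Measure E, ν.map π.proj = μ ∧
      ∑ k ∈ Finset.range n, ∫⁻ z, v z ∂(Phat.iter k).dual ν ≤ n * S + 1) :
    ∃ m ∈ π.invariantLifts Phat μ, ∫⁻ z, v z ∂m ≤ S := by
  choose ν hν hνS using fun n : ℕ => h (n + 1) (Nat.le_add_left _ _)
  have hνp := fun n => isProbabilityMeasure_of_map_proj (hν n)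
  let m : ℕ → Measure E := fun n => Phat.average (n + 1) (ν n)
  have hmmap : ∀ n, (m n).map π.proj = μ := by
    intro n
    ext A hA
    rw [Measure.map_apply π.measurable_proj hA]
    simp only [m, SigmaMarkov.average, Measure.smul_apply, Measure.finsetSum_apply]
    simp only [← Measure.map_apply π.measurable_proj hA, hdual _ _ (hν n)]
    rw [Finset.sum_const, Finset.card_range, nsmul_eq_mul, smul_eq_mul, ← mul_assoc,
      ENNReal.inv_mul_cancel (by simp) (by simp), one_mul]
  have hle : ∀ n, ∫⁻ z, v z ∂m n ≤ S + ((n + 1 : ℕ) : ℝ≥0∞)⁻¹ := by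
    intro n
    rw [Phat.lintegral_average]
    calc _ ≤ ((n + 1 : ℕ) : ℝ≥0∞)⁻¹ * (((n + 1 : ℕ) : ℝ≥0∞) * S + 1) := by
          gcongr; exact hνS n
      _ = _ := by
          rw [mul_add, ← mul_assoc, ENNReal.inv_mul_cancel (by simp) (by simp), one_mul, mul_one]
  have hle' : ∀ n, ∫⁻ z, v z ∂m n ≤ S + 1 := fun n => (hle n).trans (by
    gcongr
    rw [ENNReal.inv_le_one]
    exact_mod_cast Nat.le_add_left 1 n)
  obtain ⟨m₀, hm₀, φ, hφ, -, hlim⟩ := exists_limit_mem_invariantLifts hv hvm hvP hmmap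
    (by finiteness) hle' (fun ψ => by
      obtain ⟨C, hC⟩ := ψ.2.2
      have hb : ∀ (ρ : Measure E) [IsProbabilityMeasure ρ], |∫ z, ψ.1 z ∂ρ| ≤ C := fun ρ _ => by
        simpa using norm_integral_le_of_norm_le_const (μ := ρ) (f := ψ.1) (ae_of_all _ hC)
      have h0 : Tendsto (fun n : ℕ => ((n + 1 : ℕ) : ℝ)⁻¹ * (2 * C)) atTop (𝓝 0) := by
        have := (tendsto_inv_atTop_nhds_zero_nat (𝕜 := ℝ)).comp (tendsto_add_atTop_nat 1)
        simpa using this.mul_const (2 * C)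
      refine squeeze_zero_norm (fun n => ?_) h0
      rw [Phat.integral_toLin_average_sub, norm_mul, norm_inv, Real.norm_natCast]
      gcongr
      refine (abs_sub _ _).trans ?_
      linarith [hb ((Phat.iter (n + 1)).dual (ν n)), hb (ν n)])
  refine ⟨m₀, hm₀, hlim.trans ?_⟩
  have hT : Tendsto (fun n => S + ((φ n + 1 : ℕ) : ℝ≥0∞)⁻¹) atTop (𝓝 (S + 0)) :=
    tendsto_const_nhds.add (ENNReal.tendsto_inv_nat_nhds_zero.comp
      ((tendsto_add_atTop_nat 1).comp hφ.tendsto_atTop))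
  rw [add_zero] at hT
  exact (liminf_le_liminf (Eventually.of_forall fun n => hle (φ n))).trans hT.liminf_eq.le

/-- Test functions scaled to sup norm at most one. -/
noncomputable def testIntegral (π : CompactFiberBundle E X Y) (i : ℕ) (m : Measure E) : ℝ :=
  (1 + ‖denseTestFun Y i‖)⁻¹ * ∫ z, (π.testFun (denseTestFun Y i)).1 z ∂m

theorem abs_testIntegral_le (i : ℕ) (m : Measure E) [IsProbabilityMeasure m] :
    |π.testIntegral i m| ≤ 1 := by
  have h : |∫ z, (π.testFun (denseTestFun Y i)).1 z ∂m| ≤ ‖denseTestFun Y i‖ := by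
    simpa using norm_integral_le_of_norm_le_const (μ := m) (f := (π.testFun (denseTestFun Y i)).1)
      (ae_of_all _ fun z => (denseTestFun Y i).norm_coe_le_norm _)
  have hn := norm_nonneg (denseTestFun Y i)
  rw [testIntegral, abs_mul, abs_inv, abs_of_pos (by positivity), inv_mul_le_iff₀ (by positivity)]
  linarith

/-- A strictly convex function on the probability measures on `E`. -/
noncomputable def energy (π : CompactFiberBundle E X Y) (m : Measure E) : ℝ :=
  ∑' i, (1 / 2 : ℝ) ^ i * π.testIntegral i m ^ 2

theorem abs_energy_term_le (i : ℕ) (m : Measure E) [IsProbabilityMeasure m] :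
    ‖(1 / 2 : ℝ) ^ i * π.testIntegral i m ^ 2‖ ≤ (1 / 2 : ℝ) ^ i := by
  rw [norm_mul, norm_pow, norm_pow, Real.norm_of_nonneg (by norm_num : (0 : ℝ) ≤ 1 / 2)]
  exact mul_le_of_le_one_right (by positivity)
    (pow_le_one₀ (norm_nonneg _) (abs_testIntegral_le i m))

theorem summable_energy (m : Measure E) [IsProbabilityMeasure m] :
    Summable fun i => (1 / 2 : ℝ) ^ i * π.testIntegral i m ^ 2 :=
  Summable.of_norm_bounded summable_geometric_two fun i => abs_energy_term_le i m

theorem energy_le_two (m : Measure E) [IsProbabilityMeasure m] : π.energy m ≤ 2 :=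
  ((summable_energy m).tsum_le_tsum (fun i => (le_abs_self _).trans (abs_energy_term_le i m))
    summable_geometric_two).trans tsum_geometric_two.le

theorem tendsto_energy {m : Measure E} {ν : ℕ → Measure E} [∀ n, IsProbabilityMeasure (ν n)]
    (h : ∀ f : C((ℕ → Bool) × Y, ℝ), Tendsto (fun n => ∫ z, (π.testFun f).1 z ∂ν n) atTop
        (𝓝 (∫ z, (π.testFun f).1 z ∂m))) :
    Tendsto (fun n => π.energy (ν n)) atTop (𝓝 (π.energy m)) :=
  tendsto_tsum_of_dominated_convergence summable_geometric_two
    (fun i => (((h (denseTestFun Y i)).const_mul _).pow 2).const_mul _)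
    (Eventually.of_forall fun n i => abs_energy_term_le i (ν n))

theorem testIntegral_add {m₁ m₂ : Measure E} [IsProbabilityMeasure m₁] [IsProbabilityMeasure m₂]
    (a b : ℝ≥0) (i : ℕ) : π.testIntegral i (a • m₁ + b • m₂) =
      a * π.testIntegral i m₁ + b * π.testIntegral i m₂ := by
  rw [testIntegral, integral_add_measure (BddMeas.integrable _ _) (BddMeas.integrable _ _),
    integral_smul_nnreal_measure, integral_smul_nnreal_measure]
  simp only [testIntegral, NNReal.smul_def, smul_eq_mul]
  ring

/-- Strict convexity in the form `a s² + b t² - (a s + b t)² = a b (s - t)²` for `a + b = 1`. The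
weighted sum of these squares is at most zero, so every test integral agrees. -/
theorem eq_of_energy_le {m₁ m₂ : Measure E} [IsProbabilityMeasure m₁] [IsProbabilityMeasure m₂]
    {a b : ℝ≥0} (ha : 0 < a) (hb : 0 < b) (hab : a + b = 1)
    [IsProbabilityMeasure (a • m₁ + b • m₂)]
    (h₁ : π.energy m₁ ≤ π.energy (a • m₁ + b • m₂))
    (h₂ : π.energy m₂ ≤ π.energy (a • m₁ + b • m₂)) : m₁ = m₂ := by
  have hab' : (a : ℝ) + b = 1 := by exact_mod_cast hab
  have ha' : (0 : ℝ) < a := ha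
  have hb' : (0 : ℝ) < b := hb
  have s₁ := summable_energy (π := π) m₁
  have s₂ := summable_energy (π := π) m₂
  have s := summable_energy (π := π) (a • m₁ + b • m₂)
  have hid : ∀ i, (1 / 2 : ℝ) ^ i * (a * b * (π.testIntegral i m₁ - π.testIntegral i m₂) ^ 2) =
      a * ((1 / 2 : ℝ) ^ i * π.testIntegral i m₁ ^ 2) +
      b * ((1 / 2 : ℝ) ^ i * π.testIntegral i m₂ ^ 2) -
      (1 / 2 : ℝ) ^ i * π.testIntegral i (a • m₁ + b • m₂) ^ 2 := by
    intro i
    rw [testIntegral_add]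
    have : (b : ℝ) = 1 - a := by linarith
    rw [this]
    ring
  have hsum : Summable fun i => (1 / 2 : ℝ) ^ i *
      (a * b * (π.testIntegral i m₁ - π.testIntegral i m₂) ^ 2) := by
    simp only [hid]
    exact ((s₁.mul_left _).add (s₂.mul_left _)).sub s
  have htsum : ∑' i, (1 / 2 : ℝ) ^ i *
      (a * b * (π.testIntegral i m₁ - π.testIntegral i m₂) ^ 2) ≤ 0 := by
    simp only [hid]
    rw [((s₁.mul_left _).add (s₂.mul_left _)).tsum_sub s,
      (s₁.mul_left _).tsum_add (s₂.mul_left _), tsum_mul_left, tsum_mul_left]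
    change a * π.energy m₁ + b * π.energy m₂ - π.energy (a • m₁ + b • m₂) ≤ 0
    have e₁ := mul_le_mul_of_nonneg_left h₁ ha'.le
    have e₂ := mul_le_mul_of_nonneg_left h₂ hb'.le
    have : π.energy (a • m₁ + b • m₂) = a * π.energy (a • m₁ + b • m₂) +
      b * π.energy (a • m₁ + b • m₂) := by rw [← add_mul, hab', one_mul]
    linarith
  refine measure_eq_of_integral_denseTestFun (π := π) fun i => ?_
  have hnn : ∀ i, 0 ≤ (1 / 2 : ℝ) ^ i *
      (a * b * (π.testIntegral i m₁ - π.testIntegral i m₂) ^ 2) := fun i => by positivity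
  have hi := le_antisymm ((hsum.le_tsum i fun j _ => hnn j).trans htsum) (hnn i)
  have hn := norm_nonneg (denseTestFun Y i)
  have heq : π.testIntegral i m₁ = π.testIntegral i m₂ := by
    simpa [ha'.ne', hb'.ne', sub_eq_zero] using hi
  exact mul_left_cancel₀ (inv_ne_zero (by positivity)) heq

/-- Among the minimizers of `∫ v`, take one of maximal energy. If it is a mixture of two lifts, both
are minimizers because the minimum is finite and the cost is affine. Neither has larger energy, so
strict convexity makes them equal. -/
theorem exists_extremePoint_isMinOn [IsProbabilityMeasure μ]
    (hv : π.IsFiberwiseLSC v) (hvm : Measurable v) (hvP : π.IsAdapted Phat v)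
    {m₁ : Measure E} (hm₁ : m₁ ∈ π.invariantLifts Phat μ) (hm₁v : ∫⁻ z, v z ∂m₁ ≠ ⊤) :
    ∃ m ∈ Set.extremePoints ℝ≥0 (π.invariantLifts Phat μ),
      ∀ m' ∈ π.invariantLifts Phat μ, ∫⁻ z, v z ∂m ≤ ∫⁻ z, v z ∂m' := by
  have hlimit : ∀ (ν : ℕ → Measure E) (c₀ : ℝ≥0∞), c₀ ≠ ⊤ →
      (∀ n, ν n ∈ π.invariantLifts Phat μ) → (∀ n, ∫⁻ z, v z ∂ν n ≤ c₀) → _ :=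
    fun ν c₀ hc₀ hν hbd => exists_limit_mem_invariantLifts hv hvm hvP (fun n => (hν n).2) hc₀ hbd
      (fun ψ => by
        refine tendsto_const_nhds.congr fun n => ?_
        rw [(hν n).1.2 ψ, sub_self])
  let V : Set ℝ≥0∞ := (fun m : Measure E => ∫⁻ z, v z ∂m) '' π.invariantLifts Phat μ
  obtain ⟨c, hcanti, hclim, hcV⟩ := exists_seq_tendsto_sInf (S := V) ⟨_, m₁, hm₁, rfl⟩
    (OrderBot.bddBelow _)
  choose ν hν hνc using hcV
  have hSle : ∀ m' ∈ π.invariantLifts Phat μ, sInf V ≤ ∫⁻ z, v z ∂m' := fun m' hm' =>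
    sInf_le ⟨m', hm', rfl⟩
  have hStop : sInf V ≠ ⊤ := ne_top_of_le_ne_top hm₁v (hSle m₁ hm₁)
  obtain ⟨m₂, hm₂, hm₂v⟩ : ∃ m ∈ π.invariantLifts Phat μ, ∫⁻ z, v z ∂m ≤ sInf V := by
    -- Early terms of a minimizing sequence may have infinite cost; dropping them gives a uniform
    -- bound.
    obtain ⟨N, hN⟩ := (hclim.eventually_lt_const (ENNReal.lt_add_right hStop one_ne_zero)).exists
    obtain ⟨m, hm, φ, hφ, -, hlim⟩ := hlimit (fun n => ν (n + N)) (sInf V + 1) (by finiteness)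
      (fun n => hν _) (fun n => (hνc (n + N)).le.trans
        ((hcanti (Nat.le_add_left N n)).trans hN.le))
    refine ⟨m, hm, hlim.trans (le_of_eq ?_)⟩
    refine Tendsto.liminf_eq ?_
    have := hclim.comp ((tendsto_add_atTop_nat N).comp hφ.tendsto_atTop)
    exact this.congr fun n => (hνc _).symm
  let M : Set (Measure E) := {m | m ∈ π.invariantLifts Phat μ ∧ ∫⁻ z, v z ∂m ≤ sInf V}
  obtain ⟨e, -, helim, heM⟩ := exists_seq_tendsto_sSup (S := π.energy '' M)
    ⟨_, m₂, ⟨hm₂, hm₂v⟩, rfl⟩ ⟨2, by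
      rintro _ ⟨m, hm, rfl⟩
      have := hm.1.1.1
      exact energy_le_two m⟩
  choose ρ hρ hρe using heM
  obtain ⟨m, hm, φ, hφ, hconv, hlim⟩ := hlimit ρ (sInf V) hStop (fun n => (hρ n).1)
    (fun n => (hρ n).2)
  have hmv : ∫⁻ z, v z ∂m ≤ sInf V := hlim.trans
    ((liminf_le_liminf (Eventually.of_forall fun n => (hρ (φ n)).2)).trans
      tendsto_const_nhds.liminf_eq.le)
  have hρp : ∀ n, IsProbabilityMeasure (ρ (φ n)) := fun n => (hρ (φ n)).1.1.1
  have hme : π.energy m = sSup (π.energy '' M) := by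
    refine tendsto_nhds_unique (tendsto_energy hconv) ?_
    exact (helim.comp hφ.tendsto_atTop).congr fun n => (hρe _).symm
  have hmax : ∀ m' ∈ M, π.energy m' ≤ π.energy m := fun m' hm' => by
    rw [hme]
    refine le_csSup ⟨2, ?_⟩ ⟨m', hm', rfl⟩
    rintro _ ⟨m, hm, rfl⟩
    have := hm.1.1.1
    exact energy_le_two m
  refine ⟨m, mem_extremePoints_iff_left.2 ⟨hm, fun p hp q hq hpq => ?_⟩,
    fun m' hm' => hmv.trans (hSle m' hm')⟩
  obtain ⟨a, b, ha, hb, hab, hmab⟩ := hpq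
  have hab' : (a : ℝ≥0∞) + b = 1 := by exact_mod_cast hab
  have hvab : ∫⁻ z, v z ∂m = a * ∫⁻ z, v z ∂p + b * ∫⁻ z, v z ∂q := by
    rw [← hmab, lintegral_add_measure, lintegral_smul_measure, lintegral_smul_measure]
    rfl
  have hSab : a * sInf V + b * sInf V = sInf V := by rw [← add_mul, hab', one_mul]
  have hpM : p ∈ M := by
    refine ⟨hp, not_lt.1 fun hlt => hmv.not_gt ?_⟩
    rw [hvab, ← hSab]
    refine ENNReal.add_lt_add_of_lt_of_le (by finiteness)
      ((ENNReal.mul_lt_mul_iff_right (by simpa using ha.ne') (by finiteness)).2 hlt) ?_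
    gcongr
    exact hSle q hq
  have hqM : q ∈ M := by
    refine ⟨hq, not_lt.1 fun hlt => hmv.not_gt ?_⟩
    rw [hvab, ← hSab]
    refine ENNReal.add_lt_add_of_le_of_lt (by finiteness) ?_
      ((ENNReal.mul_lt_mul_iff_right (by simpa using hb.ne') (by finiteness)).2 hlt)
    gcongr
    exact hSle p hp
  have hpp := hp.1.1
  have hqp := hq.1.1
  have hmp : IsProbabilityMeasure (a • p + b • q) := hmab ▸ hm.1.1
  have hpq : p = q := eq_of_energy_le (π := π) ha hb hab (hmab ▸ hmax p hpM) (hmab ▸ hmax q hqM)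
  rw [← hmab, ← hpq, ← add_smul, hab, one_smul]

end CompactFiberBundle

/-! ## Adapted functions integrable for a given measure -/

namespace CompactFiberBundle

variable {E X Y : Type*} [MeasurableSpace E] [MeasurableSpace X]
  [StandardBorelSpace X] [MetricSpace Y] [CompactSpace Y] [MeasurableSpace Y] [BorelSpace Y]
  (π : CompactFiberBundle E X Y)

theorem exists_subset_isFiberwiseOpen_compl (m : Measure E) [IsFiniteMeasure m] {A : Set E}
    (hA : MeasurableSet A) {ε : ℝ≥0∞} (hε : ε ≠ 0) :
    ∃ F ⊆ A, MeasurableSet F ∧ π.IsFiberwiseOpen Fᶜ ∧ m (A \ F) ≤ ε := by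
  have hj := π.measurableEmbedding_compactify
  obtain ⟨F, hFA, hF, hFε⟩ := MeasurableSet.exists_isClosed_sdiff_lt
    (μ := m.map π.compactify) (hj.measurableSet_image.2 hA) (measure_ne_top _ _) hε
  refine ⟨π.compactify ⁻¹' F, ?_, hj.measurable hF.measurableSet, fun x =>
    ⟨{y | (cantorEmbedding X x, y) ∉ F}, ?_, ?_⟩, ?_⟩
  · refine (Set.preimage_mono hFA).trans ?_
    rw [hj.injective.preimage_image]
  · exact hF.isOpen_compl.preimage (Continuous.prodMk_right (cantorEmbedding X x))
  · rintro z rfl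
    rfl
  · rw [hj.map_apply, Set.preimage_sdiff, hj.injective.preimage_image] at hFε
    exact hFε.le

/-- A Lusin-type construction. Each `{g i > q}` and its complement are approximated from inside by
fiberwise closed `F` and `G`, and `v` counts the approximations that miss a point. Summable errors
make `v` integrable. Where `v` is bounded, finitely many approximations cover everything, so both
sets are relatively closed there and `g i` is fiberwise continuous. -/
theorem exists_isAdapted_lintegral_ne_top (Phat : SigmaMarkov E) (m : Measure E)
    [IsProbabilityMeasure m] : ∃ v : E → ℝ≥0∞, π.IsFiberwiseLSC v ∧ Measurable v ∧
      π.IsAdapted Phat v ∧ ∫⁻ z, v z ∂m ≠ ⊤ := by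
  let g : ℕ → BddMeas E := fun i => Phat.toLin (π.testFun (denseTestFun Y i))
  have hgm : ∀ i (q : ℚ), MeasurableSet {z | (q : ℝ) < (g i).1 z} := fun i q =>
    measurableSet_lt measurable_const (BddMeas.measurable (g i))
  -- The last index supplies infinitely many approximations for each pair `(i, q)`: if `v z ≤ c <
  -- N`, one of the first `N` must cover `z`.
  obtain ⟨ε, hε, hεsum⟩ := ENNReal.exists_pos_sum_of_countable one_ne_zero ((ℕ × ℚ) × ℕ)
  have hε' : ∀ a, (ε a : ℝ≥0∞) ≠ 0 := fun a => ENNReal.coe_ne_zero.2 (hε a).ne'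
  choose F hFA hFm hFo hFε using fun a : (ℕ × ℚ) × ℕ =>
    π.exists_subset_isFiberwiseOpen_compl m (hgm a.1.1 a.1.2) (hε' a)
  choose G hGA hGm hGo hGε using fun a : (ℕ × ℚ) × ℕ =>
    π.exists_subset_isFiberwiseOpen_compl m (hgm a.1.1 a.1.2).compl (hε' a)
  have hOm : ∀ a, MeasurableSet (F a ∪ G a)ᶜ := fun a => ((hFm a).union (hGm a)).compl
  let v : E → ℝ≥0∞ := fun z => ∑' a, (F a ∪ G a)ᶜ.indicator 1 z
  choose VF hVF hzVF using hFo
  choose VG hVG hzVG using hGo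
  refine ⟨v, ?_, Measurable.tsum fun a => measurable_one.indicator (hOm a), ?_, ?_⟩
  · intro t x
    have hlsc : LowerSemicontinuous fun y : Y =>
        ∑' a, (VF a x ∩ VG a x).indicator (1 : Y → ℝ≥0∞) y :=
      lowerSemicontinuous_tsum fun a =>
        ((hVF a x).inter (hVG a x)).lowerSemicontinuous_indicator zero_le_one
    refine ⟨_, hlsc.isOpen_preimage t, fun z hz => ?_⟩
    have : v z = ∑' a, (VF a x ∩ VG a x).indicator (1 : Y → ℝ≥0∞) (π.chart z).2 := by
      refine tsum_congr fun a => ?_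
      have h : z ∈ (F a ∪ G a)ᶜ ↔ (π.chart z).2 ∈ VF a x ∩ VG a x := by
        rw [Set.compl_union, Set.mem_inter_iff, Set.mem_inter_iff, hzVF a x z hz, hzVG a x z hz]
      by_cases hza : z ∈ (F a ∪ G a)ᶜ
      · rw [Set.indicator_of_mem hza, Set.indicator_of_mem (h.1 hza)]; rfl
      · rw [Set.indicator_of_notMem hza, Set.indicator_of_notMem (mt h.2 hza)]
    simp only [Set.mem_ofPred_eq, Set.mem_preimage, Set.mem_Ioi, this]
  · intro i c x T hT
    obtain ⟨N, hN⟩ := exists_nat_gt c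
    have hcover : ∀ z, v z ≤ c → ∀ q : ℚ, ∃ n < N, z ∈ F ((i, q), n) ∪ G ((i, q), n) := by
      intro z hz q
      by_contra! hno
      have h1 : ∑ n ∈ Finset.range N, (F ((i, q), n) ∪ G ((i, q), n))ᶜ.indicator
          (1 : E → ℝ≥0∞) z = N := by
        rw [Finset.sum_congr rfl fun n hn =>
          Set.indicator_of_mem (hno n (Finset.mem_range.1 hn)) (1 : E → ℝ≥0∞)]
        simp
      have h2 := ENNReal.sum_le_tsum (f := fun a => (F a ∪ G a)ᶜ.indicator (1 : E → ℝ≥0∞) z)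
        ((Finset.range N).map ⟨fun n => ((i, q), n), fun a b h => (Prod.ext_iff.1 h).2⟩)
      rw [Finset.sum_map] at h2
      have h3 : (N : ℝ≥0∞) ≤ c := h1.symm.le.trans (h2.trans hz)
      exact absurd (by exact_mod_cast h3) hN.not_ge
    -- Half-open intervals fit because the sets at hand are `{g i > p}` and `{g i ≤ q}`, both
    -- relatively open on the sublevel set.
    refine ⟨⋃ (p : ℚ × ℚ) (_ : Set.Ioc (p.1 : ℝ) p.2 ⊆ T),
      (⋂ n ∈ Finset.range N, VG ((i, p.1), n) x) ∩ ⋂ n ∈ Finset.range N, VF ((i, p.2), n) x,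
      isOpen_iUnion fun p => isOpen_iUnion fun _ =>
        (isOpen_biInter_finset fun n _ => hVG _ x).inter (isOpen_biInter_finset fun n _ => hVF _ x),
      fun z hz hzc => ?_⟩
    have hgt : ∀ q : ℚ, (q : ℝ) < (g i).1 z ↔
        (π.chart z).2 ∈ ⋂ n ∈ Finset.range N, VG ((i, q), n) x := by
      intro q
      simp only [Set.mem_iInter, ← hzVG _ x z hz]
      constructor
      · exact fun h n _ hn => hGA ((i, q), n) hn h
      · intro h
        obtain ⟨n, hn, hnF | hnG⟩ := hcover z hzc q
        · exact hFA _ hnF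
        · exact absurd hnG (h n (Finset.mem_range.2 hn))
    have hle : ∀ q : ℚ, (g i).1 z ≤ q ↔
        (π.chart z).2 ∈ ⋂ n ∈ Finset.range N, VF ((i, q), n) x := by
      intro q
      simp only [Set.mem_iInter, ← hzVF _ x z hz]
      constructor
      · exact fun h n _ hn => h.not_gt (hFA ((i, q), n) hn)
      · intro h
        obtain ⟨n, hn, hnF | hnG⟩ := hcover z hzc q
        · exact absurd hnF (h n (Finset.mem_range.2 hn))
        · exact not_lt.1 (hGA _ hnG)
    simp only [Set.mem_iUnion, Set.mem_inter_iff, ← hgt, ← hle, exists_prop, Prod.exists]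
    constructor
    · intro h
      obtain ⟨a, b, ⟨ha, hb⟩, hab⟩ := mem_nhds_iff_exists_Ioo_subset.1 (hT.mem_nhds h)
      obtain ⟨p, hap, hp⟩ := exists_rat_btwn ha
      obtain ⟨q, hq, hqb⟩ := exists_rat_btwn hb
      exact ⟨p, q, fun r hr => hab ⟨hap.trans hr.1, hr.2.trans_lt hqb⟩, hp, hq.le⟩
    · rintro ⟨p, q, hpq, hp, hq⟩
      exact hpq ⟨hp, hq⟩
  · have hOε : ∀ a, m (F a ∪ G a)ᶜ ≤ 2 * ε a := by
      intro a
      refine (measure_mono (t := ({z | (a.1.2 : ℝ) < (g a.1.1).1 z} \ F a) ∪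
        ({z | (a.1.2 : ℝ) < (g a.1.1).1 z}ᶜ \ G a)) ?_).trans ((measure_union_le _ _).trans ?_)
      · intro z hz
        rw [Set.compl_union] at hz
        by_cases h : (a.1.2 : ℝ) < (g a.1.1).1 z
        · exact Or.inl ⟨h, hz.1⟩
        · exact Or.inr ⟨h, hz.2⟩
      · rw [two_mul]
        exact add_le_add (hFε a) (hGε a)
    have : ∫⁻ z, v z ∂m ≤ 2 * ∑' a, (ε a : ℝ≥0∞) := by
      simp only [v]
      rw [lintegral_tsum fun a => (measurable_one.indicator (hOm a)).aemeasurable,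
        ← ENNReal.tsum_mul_left]
      refine ENNReal.tsum_le_tsum fun a => ?_
      rw [lintegral_indicator_one (hOm a)]
      exact hOε a
    exact ne_top_of_le_ne_top (by finiteness) (this.trans (mul_le_mul_right hεsum.le 2))

end CompactFiberBundle

/-! ## Differences of extended nonnegative functions -/

theorem EReal.antitone_coe_sub_ennreal (γ : ℝ≥0) :
    Antitone fun e : ℝ≥0∞ => ((γ : ℝ≥0∞) : EReal) - e := fun _ _ h =>
  EReal.sub_le_sub le_rfl (EReal.coe_ennreal_le_coe_ennreal_iff.2 h)

theorem EReal.continuous_coe_sub_ennreal (γ : ℝ≥0) :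
    Continuous fun e : ℝ≥0∞ => ((γ : ℝ≥0∞) : EReal) - e := by
  refine continuous_iff_continuousAt.2 fun e => ?_
  have h : ContinuousAt (fun p : EReal × EReal => p.1 + p.2)
      (((γ : ℝ≥0∞) : EReal), -(e : EReal)) :=
    EReal.continuousAt_add (Or.inl (by simp)) (Or.inl (by simp))
  have h2 : ContinuousAt (fun e : ℝ≥0∞ => (((γ : ℝ≥0∞) : EReal), -(e : EReal))) e :=
    continuousAt_const.prodMk (continuous_coe_ennreal_ereal.neg.continuousAt)
  exact ContinuousAt.comp (f := fun e : ℝ≥0∞ => (((γ : ℝ≥0∞) : EReal), -(e : EReal))) h h2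

theorem EReal.coe_ennreal_sub_div_natCast (γ : ℝ≥0) (b : ℝ≥0∞) {n : ℕ} (hn : 1 ≤ n) :
    (((n * γ : ℝ≥0∞) : EReal) - (b : EReal)) / (n : EReal) =
      ((γ : ℝ≥0∞) : EReal) - ((b / n : ℝ≥0∞) : EReal) := by
  have hn' : (0 : ℝ) < n := by exact_mod_cast hn
  have hn0 : (n : ℝ≥0) ≠ 0 := by exact_mod_cast hn'.ne'
  have h1 : (n * γ : ℝ≥0∞) = ((n * γ : ℝ≥0) : ℝ≥0∞) := by push_cast; rfl
  rw [h1]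
  induction b with
  | top =>
    rw [ENNReal.top_div_of_ne_top (ENNReal.natCast_ne_top n), EReal.coe_ennreal_top,
      EReal.sub_top, EReal.sub_top]
    exact EReal.bot_div_of_pos_ne_top (by exact_mod_cast hn) (EReal.coe_ne_top (n : ℝ))
  | coe b =>
    have h2 : ((b : ℝ≥0∞) / n) = ((b / n : ℝ≥0) : ℝ≥0∞) := by
      rw [ENNReal.coe_div hn0]; rfl
    rw [h2]
    change ((((n * γ : ℝ≥0) : ℝ) : EReal) - ((b : ℝ) : EReal)) / ((n : ℝ) : EReal) =
      ((γ : ℝ) : EReal) - (((b / n : ℝ≥0) : ℝ) : EReal)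
    rw [← EReal.coe_sub, ← EReal.coe_sub, ← EReal.coe_div]
    congr 1
    push_cast
    field_simp

theorem EReal.toENNReal_coe_sub_add {a : ℝ≥0∞} (ha : a ≠ ⊤) (b : ℝ≥0∞) :
    ((a : EReal) - b).toENNReal + b = (-((a : EReal) - b)).toENNReal + a := by
  lift a to ℝ≥0 using ha
  induction b with
  | top => simp
  | coe b =>
    change (((a : ℝ) : EReal) - ((b : ℝ) : EReal)).toENNReal + b =
      (-(((a : ℝ) : EReal) - ((b : ℝ) : EReal))).toENNReal + a
    rw [← EReal.coe_sub, ← EReal.coe_neg, EReal.real_coe_toENNReal, EReal.real_coe_toENNReal,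
      ← ENNReal.ofReal_coe_nnreal (p := a), ← ENNReal.ofReal_coe_nnreal (p := b)]
    rcases le_total (a : ℝ) b with h | h
    · rw [ENNReal.ofReal_of_nonpos (by linarith), zero_add, ← ENNReal.ofReal_add (by linarith)
        a.coe_nonneg]
      congr 1; ring
    · rw [ENNReal.ofReal_of_nonpos (by linarith : -((a : ℝ) - b) ≤ 0), zero_add,
        ← ENNReal.ofReal_add (by linarith) b.coe_nonneg]
      congr 1; ring

theorem EReal.coe_ennreal_sub_eq_of_add_eq {p q a b : ℝ≥0∞} (hp : p ≠ ⊤) (ha : a ≠ ⊤)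
    (h : p + b = q + a) : (p : EReal) - q = (a : EReal) - b := by
  lift a to ℝ≥0 using ha
  lift p to ℝ≥0 using hp
  rcases eq_or_ne b ⊤ with rfl | hb
  · have hq : q = ⊤ := by
      by_contra hq
      rw [add_top] at h
      exact ENNReal.add_ne_top.2 ⟨hq, ENNReal.coe_ne_top⟩ h.symm
    rw [hq, EReal.coe_ennreal_top, EReal.sub_top, EReal.sub_top]
  · have hq : q ≠ ⊤ := by
      rintro rfl
      rw [top_add] at h
      exact ENNReal.add_ne_top.2 ⟨ENNReal.coe_ne_top, hb⟩ h
    lift b to ℝ≥0 using hb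
    lift q to ℝ≥0 using hq
    have h' : (p : ℝ) + b = q + a := by exact_mod_cast h
    change ((p : ℝ) : EReal) - ((q : ℝ) : EReal) = ((a : ℝ) : EReal) - ((b : ℝ) : EReal)
    rw [← EReal.coe_sub, ← EReal.coe_sub]
    congr 1
    linarith

theorem EReal.sub_add_sub_ennreal {a a' : ℝ≥0∞} (ha : a ≠ ⊤) (ha' : a' ≠ ⊤) (b b' : ℝ≥0∞) :
    ((a : EReal) - b) + ((a' : EReal) - b') =
      ((a + a' : ℝ≥0∞) : EReal) - ((b + b' : ℝ≥0∞) : EReal) := by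
  lift a to ℝ≥0 using ha
  lift a' to ℝ≥0 using ha'
  rcases eq_or_ne b ⊤ with rfl | hb
  · simp
  rcases eq_or_ne b' ⊤ with rfl | hb'
  · simp
  lift b to ℝ≥0 using hb
  lift b' to ℝ≥0 using hb'
  change (((a : ℝ) : EReal) - ((b : ℝ) : EReal)) + (((a' : ℝ) : EReal) - ((b' : ℝ) : EReal)) =
    (((a + a' : ℝ≥0) : ℝ) : EReal) - (((b + b' : ℝ≥0) : ℝ) : EReal)
  rw [← EReal.coe_sub, ← EReal.coe_sub, ← EReal.coe_sub, ← EReal.coe_add]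
  congr 1
  push_cast
  ring

theorem EReal.sum_sub_ennreal {n : ℕ} {a b : ℕ → ℝ≥0∞} (ha : ∀ k < n, a k ≠ ⊤) :
    ∑ k ∈ Finset.range n, ((a k : EReal) - b k) =
      ((∑ k ∈ Finset.range n, a k : ℝ≥0∞) : EReal) -
        ((∑ k ∈ Finset.range n, b k : ℝ≥0∞) : EReal) := by
  induction n with
  | zero => simp
  | succ n ih =>
    rw [Finset.sum_range_succ, Finset.sum_range_succ, Finset.sum_range_succ,
      ih fun k hk => ha k (hk.trans n.lt_succ_self),
      EReal.sub_add_sub_ennreal _ (ha n n.lt_succ_self)]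
    exact ENNReal.sum_ne_top.2 fun k hk => ha k ((Finset.mem_range.1 hk).trans n.lt_succ_self)

/-- Integrate `f⁺ + b = f⁻ + a`, which avoids subtraction and remains true where `b = ∞`; finiteness
of `∫ a` allows rearranging afterwards. -/
theorem extInt_eq_sub {Z : Type*} [MeasurableSpace Z] {ν : Measure Z} {f : Z → EReal}
    {a b : Z → ℝ≥0∞} (ha : AEMeasurable a ν) (hb : AEMeasurable b ν)
    (hf : ∀ᵐ z ∂ν, f z = (a z : EReal) - b z) (hai : ∫⁻ z, a z ∂ν ≠ ⊤) :
    extInt ν f = ((∫⁻ z, a z ∂ν : ℝ≥0∞) : EReal) - ((∫⁻ z, b z ∂ν : ℝ≥0∞) : EReal) := by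
  have hat : ∀ᵐ z ∂ν, a z ≠ ⊤ := (ae_lt_top' ha hai).mono fun z hz => hz.ne
  refine EReal.coe_ennreal_sub_eq_of_add_eq (ne_top_of_le_ne_top hai (lintegral_mono_ae ?_)) hai ?_
  · filter_upwards [hf] with z hz
    rw [hz]
    refine (EReal.toENNReal_le_toENNReal ?_).trans_eq EReal.toENNReal_coe
    exact EReal.sub_le_of_le_add (le_add_of_nonneg_right (EReal.coe_ennreal_nonneg _))
  · rw [← lintegral_add_right' _ hb, ← lintegral_add_right' _ ha]
    refine lintegral_congr_ae ?_
    filter_upwards [hf, hat] with z hz hzt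
    rw [hz]
    exact EReal.toENNReal_coe_sub_add hzt _

/-- Fekete's lemma, with values in `[0, ∞]`. -/
theorem ENNReal.tendsto_div_of_superadditive {b : ℕ → ℝ≥0∞} (h : ∀ m n, b m + b n ≤ b (m + n)) :
    Tendsto (fun n : ℕ => b n / n) atTop (𝓝 (⨆ n : {n : ℕ // 1 ≤ n}, b n / (n : ℕ))) := by
  have hmul : ∀ m q : ℕ, (q : ℝ≥0∞) * b m ≤ b (q * m) := by
    intro m q
    induction q with
    | zero => simp
    | succ q ih =>
      push_cast
      rw [add_mul, one_mul, add_mul, one_mul]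
      exact (add_le_add ih le_rfl).trans (h _ _)
  refine tendsto_order.2 ⟨fun c hc => ?_, fun c hc => ?_⟩
  · obtain ⟨⟨m, hm⟩, hcm⟩ := lt_iSup_iff.1 hc
    have hm0 : (m : ℝ≥0∞) ≠ 0 := by exact_mod_cast (Nat.one_le_iff_ne_zero.1 hm)
    have hmt : (m : ℝ≥0∞) ≠ ⊤ := ENNReal.natCast_ne_top m
    -- The factor `1/m - 1/n` is a lower bound for `⌊n/m⌋ / n`.
    have hlim : Tendsto (fun n : ℕ => ((m : ℝ≥0∞)⁻¹ - (n : ℝ≥0∞)⁻¹) * b m) atTop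
        (𝓝 (((m : ℝ≥0∞)⁻¹ - 0) * b m)) :=
      ENNReal.Tendsto.mul_const (ENNReal.Tendsto.sub tendsto_const_nhds
        ENNReal.tendsto_inv_nat_nhds_zero (Or.inr ENNReal.zero_ne_top))
        (Or.inl (by simp))
    rw [tsub_zero, ← ENNReal.div_eq_inv_mul] at hlim
    filter_upwards [hlim.eventually_const_lt hcm, eventually_ge_atTop 1] with n hn hn1
    have hn0 : (n : ℝ≥0∞) ≠ 0 := by exact_mod_cast (Nat.one_le_iff_ne_zero.1 hn1)
    have hnt : (n : ℝ≥0∞) ≠ ⊤ := ENNReal.natCast_ne_top n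
    refine hn.trans_le ?_
    rw [ENNReal.le_div_iff_mul_le (Or.inl hn0) (Or.inl hnt), mul_right_comm]
    have hq : ((m : ℝ≥0∞)⁻¹ - (n : ℝ≥0∞)⁻¹) * n ≤ ((n / m : ℕ) : ℝ≥0∞) := by
      rw [ENNReal.sub_mul fun _ _ => hnt, ENNReal.inv_mul_cancel hn0 hnt, tsub_le_iff_right,
        ← ENNReal.div_eq_inv_mul, ENNReal.div_le_iff_le_mul (Or.inl hm0) (Or.inl hmt)]
      have : n ≤ (n / m + 1) * m := by
        have := Nat.div_add_mod n m
        have := Nat.mod_lt n hm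
        nlinarith
      exact_mod_cast this
    calc _ ≤ ((n / m : ℕ) : ℝ≥0∞) * b m := by gcongr
      _ ≤ b (n / m * m) := hmul _ _
      _ ≤ b (n / m * m) + b (n % m) := le_self_add
      _ ≤ b (n / m * m + n % m) := h _ _
      _ = b n := by rw [Nat.div_add_mod']
  · filter_upwards [eventually_ge_atTop 1] with n hn
    exact (le_iSup (fun n : {n : ℕ // 1 ≤ n} => b n / (n : ℕ)) ⟨n, hn⟩).trans_lt hc

/-! ## The growth rate in terms of a nonnegative cost -/

namespace SigmaMarkov

variable {Z : Type*} [MeasurableSpace Z] (Q : SigmaMarkov Z)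

/-- The sums `∑_{k < n} Q ^ k v` of a nonnegative function. -/
noncomputable def actSum (v : Z → ℝ≥0∞) (n : ℕ) (z : Z) : ℝ≥0∞ :=
  ∑ k ∈ Finset.range n, (Q.iter k).act v z

theorem measurable_actSum {v : Z → ℝ≥0∞} (hv : Measurable v) (n : ℕ) :
    Measurable (Q.actSum v n) :=
  Finset.measurable_fun_sum _ fun k _ => (Q.iter k).measurable_act hv

theorem lintegral_actSum {v : Z → ℝ≥0∞} (hv : Measurable v) (n : ℕ) (ν : Measure Z) :
    ∫⁻ z, Q.actSum v n z ∂ν = ∑ k ∈ Finset.range n, ∫⁻ z, v z ∂(Q.iter k).dual ν := by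
  simp only [actSum]
  rw [lintegral_finsetSum _ fun k _ => (Q.iter k).measurable_act hv]
  exact Finset.sum_congr rfl fun k _ => ((Q.iter k).lintegral_dual ν hv).symm

end SigmaMarkov

namespace CompactFiberBundle

variable {E X Y : Type*} [MeasurableSpace E] [MeasurableSpace X]
  [MetricSpace Y] [MeasurableSpace Y]
  {π : CompactFiberBundle E X Y} {Phat : SigmaMarkov E} {P : SigmaMarkov X} {μ : Measure X}
  {v : E → ℝ≥0∞}

theorem extInt_eq_sub_lintegral {G : X → ℝ≥0} (hG : Measurable G) (hv : Measurable v)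
    {φhat : E → EReal}
    (hφ : ∀ᵐ x ∂μ, ∀ z, π.proj z = x → φhat z = ((G x : ℝ≥0∞) : EReal) - v z)
    (hGi : ∫⁻ x, G x ∂μ ≠ ⊤) {ν : Measure E} (hν : ν.map π.proj = μ) :
    extInt ν φhat = ((∫⁻ x, G x ∂μ : ℝ≥0∞) : EReal) - ((∫⁻ z, v z ∂ν : ℝ≥0∞) : EReal) := by
  have hG' : Measurable fun x => (G x : ℝ≥0∞) := hG.coe_nnreal_ennreal
  have hint : ∫⁻ z, G (π.proj z) ∂ν = ∫⁻ x, G x ∂μ := by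
    rw [← hν, lintegral_map hG' π.measurable_proj]
  rw [← hint]
  refine extInt_eq_sub (hG'.comp π.measurable_proj).aemeasurable hv.aemeasurable ?_
    (by rwa [hint])
  filter_upwards [ae_of_ae_map π.measurable_proj.aemeasurable (hν.symm ▸ hφ)] with z hz
  exact hz z rfl

theorem ae_additiveSeq_eq_sub [IsProbabilityMeasure μ] (hfactor : ∀ φ : BddMeas X,
      Phat.toLin (BddMeas.pullback π.proj π.measurable_proj φ) =
        BddMeas.pullback π.proj π.measurable_proj (P.toLin φ)) (hμ : μ ∈ invariantMeasures P)
    {G : X → ℝ≥0} (hG : Measurable G) (hv : Measurable v) {φhat : E → EReal}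
    (hφ : ∀ᵐ x ∂μ, ∀ z, π.proj z = x → φhat z = ((G x : ℝ≥0∞) : EReal) - v z)
    (hGi : ∫⁻ x, G x ∂μ ≠ ⊤) (n : ℕ) :
    ∀ᵐ x ∂μ, P.actSum (fun x => G x) n x ≠ ⊤ ∧ ∀ z, π.proj z = x → additiveSeq Phat φhat n z =
      ((P.actSum (fun x => G x) n x : ℝ≥0∞) : EReal) - (Phat.actSum v n z : ℝ≥0∞) := by
  have hG' : Measurable fun x => (G x : ℝ≥0∞) := hG.coe_nnreal_ennreal
  have hk : ∀ k, ∀ᵐ x ∂μ, (P.iter k).act (fun x => G x) x ≠ ⊤ ∧ ∀ z, π.proj z = x →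
      (Phat.iter k).extend φhat z =
        (((P.iter k).act (fun x => G x) x : ℝ≥0∞) : EReal) - ((Phat.iter k).act v z : ℝ≥0∞) := by
    intro k
    have hinv := P.dual_iter_of_mem hμ k
    have h1 : ∀ᵐ x ∂μ, (P.iter k).act (fun x => G x) x < ⊤ :=
      ae_lt_top ((P.iter k).measurable_act hG') (by
        rwa [← (P.iter k).lintegral_dual μ hG', hinv])
    -- Invariance of `μ` transfers the identity from `μ` to the kernel at almost every `x`. As the
    -- kernel at `z` lies over the one at `π z`, the previous lemma applies with the kernel as base
    -- measure.
    have h2 : ∀ᵐ x ∂μ, ∀ᵐ x' ∂(P.iter k).kernel x,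
        ∀ z, π.proj z = x' → φhat z = ((G x' : ℝ≥0∞) : EReal) - v z :=
      Measure.ae_ae_of_ae_bind (P.iter k).measurable_kernel.aemeasurable (by
        change ∀ᵐ b ∂(P.iter k).dual μ, _
        rwa [hinv])
    filter_upwards [h1, h2] with x hx1 hx2
    refine ⟨hx1.ne, ?_⟩
    rintro z rfl
    have hmap := map_kernel_of_factor π.measurable_proj
      (factor_iter π.measurable_proj hfactor k) z
    exact extInt_eq_sub_lintegral (π := π) hG hv hx2 hx1.ne hmap
  filter_upwards [ae_all_iff.2 hk] with x hx
  refine ⟨ENNReal.sum_ne_top.2 fun k _ => (hx k).1, fun z hz => ?_⟩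
  rw [additiveSeq, Finset.sum_congr rfl fun k _ => (hx k).2 z hz]
  exact EReal.sum_sub_ennreal fun k _ => (hx k).1

/-- The nonnegative function `G - φhat`, where `G` bounds the positive part of `φhat`. -/
noncomputable def cost (π : CompactFiberBundle E X Y) (φhat : E → EReal) (G : X → ℝ≥0) (z : E) :
    ℝ≥0∞ :=
  ((G (π.proj z) : ℝ≥0∞) - (φhat z).toENNReal) + (-φhat z).toENNReal

theorem measurable_cost {φhat : E → EReal} (hφ : Measurable φhat) {G : X → ℝ≥0}
    (hG : Measurable G) : Measurable (π.cost φhat G) :=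
  (((hG.comp π.measurable_proj).coe_nnreal_ennreal.sub hφ.ereal_toENNReal)).add
    hφ.neg.ereal_toENNReal

theorem eq_sub_cost {φhat : E → EReal} {G : X → ℝ≥0} {z : E}
    (h : (φhat z).toENNReal ≤ G (π.proj z)) :
    φhat z = ((G (π.proj z) : ℝ≥0∞) : EReal) - (π.cost φhat G z : ℝ≥0∞) := by
  rw [cost]
  generalize G (π.proj z) = g at h ⊢
  generalize φhat z = e at h ⊢
  induction e with
  | bot => simp
  | top => simp at h
  | coe r =>
    rw [← EReal.coe_neg, EReal.real_coe_toENNReal, EReal.real_coe_toENNReal] at *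
    change (r : EReal) = ((g : ℝ) : EReal) -
      (((g - r.toNNReal + (-r).toNNReal : ℝ≥0) : ℝ) : EReal)
    have h' : r.toNNReal ≤ g := ENNReal.coe_le_coe.1 h
    rw [← EReal.coe_sub]
    congr 1
    rw [NNReal.coe_add, NNReal.coe_sub h', Real.coe_toNNReal', Real.coe_toNNReal']
    rcases le_total r 0 with h0 | h0
    · rw [max_eq_right h0, max_eq_left (by linarith)]; ring
    · rw [max_eq_left h0, max_eq_right (by linarith)]; ring

/-- On a fiber `G` is a finite constant, so the cost is a continuous antitone function of `φhat`. -/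
theorem isFiberwiseLSC_cost {φhat : E → EReal} (hφ : π.FiberwiseUSC φhat) (G : X → ℝ≥0) :
    π.IsFiberwiseLSC (π.cost φhat G) := by
  intro t x
  let h : EReal → ℝ≥0∞ := fun e => ((G x : ℝ≥0∞) - e.toENNReal) + (-e).toENNReal
  have hc : Continuous h := ((ENNReal.continuous_sub_left ENNReal.coe_ne_top).comp
    EReal.continuous_toENNReal).add (EReal.continuous_toENNReal.comp continuous_neg)
  have ha : Antitone h := fun a b hab => add_le_add
    (tsub_le_tsub_left (EReal.toENNReal_le_toENNReal hab) _)
    (EReal.toENNReal_le_toENNReal (EReal.neg_le_neg_iff.2 hab))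
  let := π.fiberTopology
  obtain ⟨u, hu, hue⟩ := lowerSemicontinuousOn_iff_preimage_Ioi.1
    (hc.comp_upperSemicontinuousOn_antitone (hφ x) ha) t
  obtain ⟨V, hV, rfl⟩ := isOpen_induced_iff.1 hu
  refine ⟨V, hV, fun z hz => ?_⟩
  have hz' : z ∈ π.proj ⁻¹' {x} := hz
  have he := Set.ext_iff.1 hue z
  simp only [Set.mem_inter_iff, hz', true_and] at he
  have hcost : π.cost φhat G z = h (φhat z) := by rw [cost, hz]
  rw [Set.mem_ofPred_eq, hcost]
  exact he

theorem cost_eq_top {φhat : E → EReal} {G : X → ℝ≥0} {z : E} (h : φhat z = ⊥) :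
    π.cost φhat G z = ⊤ := by
  simp [cost, h]

/-- A decomposition of `m` projects to one of `μ`. Extremality of `μ` forces both parts to lie over
`μ`, and extremality of `m` among lifts applies. -/
theorem mem_extremePoints_invariantMeasures
    (hfactor : ∀ φ : BddMeas X, Phat.toLin (BddMeas.pullback π.proj π.measurable_proj φ) =
        BddMeas.pullback π.proj π.measurable_proj (P.toLin φ))
    (hμ : IsErgodicFor P μ) {m : Measure E}
    (hm : m ∈ Set.extremePoints ℝ≥0 (π.invariantLifts Phat μ)) : IsErgodicFor Phat m := by
  have hproj : ∀ p ∈ invariantMeasures Phat, p.map π.proj ∈ invariantMeasures P := by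
    intro p hp
    have hpp := hp.1
    refine P.mem_invariantMeasures_iff.2
      ⟨Measure.isProbabilityMeasure_map π.measurable_proj.aemeasurable, ?_⟩
    rw [← map_dual_of_factor π.measurable_proj hfactor, (Phat.mem_invariantMeasures_iff.1 hp).2]
  refine mem_extremePoints_iff_left.2 ⟨hm.1.1, fun p hp q hq hpq => ?_⟩
  have hseg : μ ∈ openSegment ℝ≥0 (p.map π.proj) (q.map π.proj) := by
    obtain ⟨a, b, ha, hb, hab, hmab⟩ := hpq
    refine ⟨a, b, ha, hb, hab, ?_⟩
    rw [← hm.1.2, ← hmab, Measure.map_add _ _ π.measurable_proj, Measure.map_smul,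
      Measure.map_smul]
  obtain ⟨h1, h2⟩ := (mem_extremePoints.1 hμ).2 _ (hproj p hp) _ (hproj q hq) hseg
  exact (mem_extremePoints_iff_left.1 hm).2 p ⟨hp, h1⟩ q ⟨hq, h2⟩ hpq

theorem map_dual_iter_eq
    (hfactor : ∀ φ : BddMeas X, Phat.toLin (BddMeas.pullback π.proj π.measurable_proj φ) =
        BddMeas.pullback π.proj π.measurable_proj (P.toLin φ))
    (hμ : μ ∈ invariantMeasures P) (n : ℕ) {ν : Measure E} (hν : ν.map π.proj = μ) :
    ((Phat.iter n).dual ν).map π.proj = μ := by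
  rw [map_dual_of_factor π.measurable_proj (factor_iter π.measurable_proj hfactor n), hν,
    P.dual_iter_of_mem hμ]

variable [StandardBorelSpace X]

theorem isAdapted_of_disjoint [CompactSpace Y] [BorelSpace Y] {K : Set E}
    (hi : ∀ ψ : BddMeas E, π.FiberwiseContinuous ψ.1 →
      π.FiberwiseContinuousOff K (Phat.toLin ψ).1) (hvK : ∀ z ∈ K, v z = ⊤) :
    π.IsAdapted Phat v := fun i c =>
  (hi _ (π.fiberwiseContinuous_testFun _)).isFiberwiseContinuousOn
    (Set.disjoint_left.2 fun z hz hzK => by simp [hvK z hzK] at hz)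

/-- The least total cost of `n` steps over lifts of `μ`. -/
noncomputable def minCost (π : CompactFiberBundle E X Y) (Phat : SigmaMarkov E) (μ : Measure X)
    (v : E → ℝ≥0∞) (n : ℕ) : ℝ≥0∞ :=
  ∫⁻ x, fiberInf π.proj (Phat.actSum v n) x ∂μ

variable [StandardBorelSpace E]

theorem minCost_le [IsFiniteMeasure μ] (hv : Measurable v) (n : ℕ) {ν : Measure E}
    (hν : ν.map π.proj = μ) :
    π.minCost Phat μ v n ≤ ∑ k ∈ Finset.range n, ∫⁻ z, v z ∂(Phat.iter k).dual ν := by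
  rw [← Phat.lintegral_actSum hv]
  exact lintegral_fiberInf_le π.measurable_proj (Phat.measurable_actSum hv n) hν

theorem exists_lift_sum_le_minCost_add [IsProbabilityMeasure μ] (hv : Measurable v) (n : ℕ)
    {ε : ℝ≥0∞} (hε : ε ≠ 0) : ∃ ν : Measure E, ν.map π.proj = μ ∧
      ∑ k ∈ Finset.range n, ∫⁻ z, v z ∂(Phat.iter k).dual ν ≤ π.minCost Phat μ v n + ε := by
  obtain ⟨ν, hν, hle⟩ := exists_map_eq_lintegral_le (μ := μ) π.measurable_proj π.surjective_proj
    (Phat.measurable_actSum hv n) hε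
  exact ⟨ν, hν, by rwa [← Phat.lintegral_actSum hv]⟩

/-- Take a lift nearly optimal for `m + n` steps. Its first `m` steps cost at least the minimum, and
the other `n` start from its `m`-th image, again a lift of `μ`. -/
theorem minCost_add_le [IsProbabilityMeasure μ] (hv : Measurable v)
    (hdual : ∀ n, ∀ ν : Measure E, ν.map π.proj = μ → ((Phat.iter n).dual ν).map π.proj = μ)
    (m n : ℕ) : π.minCost Phat μ v m + π.minCost Phat μ v n ≤ π.minCost Phat μ v (m + n) := by
  refine ENNReal.le_of_forall_pos_le_add fun ε hε _ => ?_
  obtain ⟨ν, hν, hle⟩ := exists_lift_sum_le_minCost_add (π := π) (Phat := Phat) (μ := μ) hv (m + n)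
    (ENNReal.coe_ne_zero.2 hε.ne')
  refine le_trans ?_ hle
  rw [Finset.sum_range_add]
  refine add_le_add (minCost_le hv m hν) ((minCost_le hv n (hdual m ν hν)).trans_eq ?_)
  exact Finset.sum_congr rfl fun k _ => by rw [add_comm m k, Phat.dual_iter_add]

theorem minCost_le_mul_lintegral [IsProbabilityMeasure μ] (hv : Measurable v) (n : ℕ)
    {m : Measure E} (hm : m ∈ π.invariantLifts Phat μ) :
    π.minCost Phat μ v n ≤ n * ∫⁻ z, v z ∂m := by
  refine (minCost_le hv n hm.2).trans_eq ?_
  rw [Finset.sum_congr rfl fun k _ => by rw [Phat.dual_iter_of_mem hm.1 k]]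
  simp

/-- On almost every fiber the sums of `G` are a finite constant `g`, and `e ↦ g - e` is continuous
and antitone, so it turns the infimum of the costs into the supremum. -/
theorem extInt_fiberSup_additiveSeq [IsProbabilityMeasure μ] (hfactor : ∀ φ : BddMeas X,
      Phat.toLin (BddMeas.pullback π.proj π.measurable_proj φ) =
        BddMeas.pullback π.proj π.measurable_proj (P.toLin φ)) (hμ : μ ∈ invariantMeasures P)
    {G : X → ℝ≥0} (hG : Measurable G) (hv : Measurable v) {φhat : E → EReal}
    (hφ : ∀ᵐ x ∂μ, ∀ z, π.proj z = x → φhat z = ((G x : ℝ≥0∞) : EReal) - v z)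
    (hGi : ∫⁻ x, G x ∂μ ≠ ⊤) (n : ℕ) :
    extInt μ (π.fiberSup (additiveSeq Phat φhat n)) =
      ((n * ∫⁻ x, G x ∂μ : ℝ≥0∞) : EReal) - (π.minCost Phat μ v n : ℝ≥0∞) := by
  have hG' : Measurable fun x => (G x : ℝ≥0∞) := hG.coe_nnreal_ennreal
  have hsum : ∫⁻ x, P.actSum (fun x => G x) n x ∂μ = n * ∫⁻ x, G x ∂μ := by
    rw [P.lintegral_actSum hG', Finset.sum_congr rfl fun k _ => by rw [P.dual_iter_of_mem hμ k]]
    simp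
  rw [← hsum]
  refine extInt_eq_sub (P.measurable_actSum hG' n).aemeasurable
    (aemeasurable_fiberInf π.measurable_proj (Phat.measurable_actSum hv n)) ?_
    (by rw [hsum]; finiteness)
  filter_upwards [ae_additiveSeq_eq_sub hfactor hμ hG hv hφ hGi n] with x ⟨hx, hxz⟩
  lift P.actSum (fun x => G x) n x to ℝ≥0 using hx with g
  have : Nonempty (π.proj ⁻¹' {x}) := by
    obtain ⟨z, hz⟩ := π.surjective_proj x
    exact ⟨⟨z, hz⟩⟩
  rw [fiberSup, fiberInf, iSup_subtype', iInf_subtype']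
  rw [(EReal.antitone_coe_sub_ennreal g).map_ciInf_of_continuousAt
    (EReal.continuous_coe_sub_ennreal g).continuousAt]
  exact iSup_congr fun z => hxz z.1 z.2

/-- The fiberwise supremum is only almost everywhere measurable and may be infinite on a null set;
`G` is a finite measurable version of its positive part. -/
theorem exists_integrable_majorant [IsFiniteMeasure μ] {φhat : E → EReal} (hφ : Measurable φhat)
    (hint : ∫⁻ x, (π.fiberSup φhat x).toENNReal ∂μ < ⊤) :
    ∃ G : X → ℝ≥0, Measurable G ∧ ∫⁻ x, G x ∂μ ≠ ⊤ ∧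
      ∀ᵐ x ∂μ, ∀ z, π.proj z = x → (φhat z).toENNReal ≤ G x := by
  have hm : AEMeasurable (fun x => (π.fiberSup φhat x).toENNReal) μ :=
    measurable_ereal_toENNReal.comp_aemeasurable (aemeasurable_iSup_fiber π.measurable_proj hφ)
  have hfin := ae_lt_top' hm hint.ne
  refine ⟨fun x => (hm.mk _ x).toNNReal, hm.measurable_mk.ennreal_toNNReal, ?_, ?_⟩
  · refine ne_top_of_le_ne_top hint.ne ?_
    rw [lintegral_congr_ae hm.ae_eq_mk]
    exact lintegral_mono fun x => ENNReal.coe_toNNReal_le_self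
  · filter_upwards [hfin, hm.ae_eq_mk] with x hx hxe
    rintro z rfl
    rw [← hxe, ENNReal.coe_toNNReal hx.ne]
    exact EReal.toENNReal_le_toENNReal (le_iSup₂_of_le z rfl le_rfl)

end CompactFiberBundle

/-! ### The variational principle -/

open CompactFiberBundle in
theorem theoremB {E X Y : Type*} [MeasurableSpace E] [StandardBorelSpace E]
    [MeasurableSpace X] [StandardBorelSpace X]
    [MetricSpace Y] [CompactSpace Y] [MeasurableSpace Y] [BorelSpace Y]
    (π : CompactFiberBundle E X Y) (Phat : SigmaMarkov E) (P : SigmaMarkov X)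
    (hfactor : ∀ φ : BddMeas X,
      Phat.toLin (BddMeas.pullback π.proj π.measurable_proj φ) =
        BddMeas.pullback π.proj π.measurable_proj (P.toLin φ))
    (φhat : E → EReal) (hφ_meas : Measurable φhat) (hφ_top : ∀ z, φhat z < ⊤)
    (hφ_usc : π.FiberwiseUSC φhat)
    (μ : Measure X) (hμ : μ ∈ invariantMeasures P)
    (hφ_int : ∫⁻ x, (π.fiberSup φhat x).toENNReal ∂μ < ⊤)
    (K : Set E) (hK : MeasurableSet K)
    (hi : ∀ ψ : BddMeas E, π.FiberwiseContinuous ψ.1 →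
      π.FiberwiseContinuousOff K (Phat.toLin ψ).1)
    (hii : ∀ z ∈ K, φhat z = ⊥)
    (φ : ℕ → X → EReal) (hφ : ∀ n, φ n = π.fiberSup (additiveSeq Phat φhat n))
    (Λ : EReal) (hΛ : Λ = growthRate μ φ) :
    -- the growth rate is a limit and lies in `[-∞, ∞)`
    Tendsto (fun n : ℕ => extInt μ (φ n) / (n : EReal)) atTop (𝓝 Λ) ∧ Λ < ⊤ ∧
    -- the variational formula (a supremum over the empty set is `-∞`)
    Λ = ⨆ m ∈ π.invariantLifts Phat μ, extInt m φhat ∧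
    -- invariant lifts exist, except possibly when `Λ = -∞` and `K ≠ ∅`
    (⊥ < Λ ∨ K = ∅ → (π.invariantLifts Phat μ).Nonempty) ∧
    -- if there are invariant lifts, the supremum is attained at an extreme one,
    -- which is ergodic for `Phat` when `μ` is ergodic for `P`
    ((π.invariantLifts Phat μ).Nonempty →
      ∃ m ∈ Set.extremePoints ℝ≥0 (π.invariantLifts Phat μ),
        extInt m φhat = Λ ∧ (IsErgodicFor P μ → IsErgodicFor Phat m)) ∧
    -- maximizing lifts do not charge `K` when `Λ > -∞`
    (⊥ < Λ → ∀ m ∈ π.invariantLifts Phat μ, extInt m φhat = Λ → m K = 0) := by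
  have hμp : IsProbabilityMeasure μ := hμ.1
  obtain ⟨G, hG, hGi, hGle⟩ := exists_integrable_majorant hφ_meas hφ_int
  let v := π.cost φhat G
  have hv : π.IsFiberwiseLSC v := isFiberwiseLSC_cost hφ_usc G
  have hvm : Measurable v := measurable_cost hφ_meas hG
  have hvK : ∀ z ∈ K, v z = ⊤ := fun z hz => cost_eq_top (hii z hz)
  have hvP : π.IsAdapted Phat v := isAdapted_of_disjoint hi hvK
  have hφv : ∀ᵐ x ∂μ, ∀ z, π.proj z = x → φhat z = ((G x : ℝ≥0∞) : EReal) - v z := by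
    filter_upwards [hGle] with x hx
    rintro z rfl
    exact eq_sub_cost (hx z rfl)
  have hdual := fun n (ν : Measure E) hν => map_dual_iter_eq (ν := ν) hfactor hμ n hν
  obtain ⟨γ, hγ⟩ : ∃ γ : ℝ≥0, (γ : ℝ≥0∞) = ∫⁻ x, G x ∂μ := ⟨_, ENNReal.coe_toNNReal hGi⟩
  have hlift : ∀ m ∈ π.invariantLifts Phat μ,
      extInt m φhat = ((γ : ℝ≥0∞) : EReal) - ((∫⁻ z, v z ∂m : ℝ≥0∞) : EReal) := fun m hm => by
    rw [hγ]; exact extInt_eq_sub_lintegral hG hvm hφv hGi hm.2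
  let b : ℕ → ℝ≥0∞ := π.minCost Phat μ v
  have hdiv : ∀ n : ℕ, 1 ≤ n → extInt μ (φ n) / (n : EReal) =
      ((γ : ℝ≥0∞) : EReal) - ((b n / n : ℝ≥0∞) : EReal) := fun n hn => by
    rw [hφ, extInt_fiberSup_additiveSeq hfactor hμ hG hvm hφv hGi, ← hγ,
      EReal.coe_ennreal_sub_div_natCast γ _ hn]
  let S : ℝ≥0∞ := ⨆ n : {n : ℕ // 1 ≤ n}, b n / (n : ℕ)
  have : Nonempty {n : ℕ // 1 ≤ n} := ⟨⟨1, le_rfl⟩⟩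
  have hΛS : Λ = ((γ : ℝ≥0∞) : EReal) - (S : EReal) := by
    rw [hΛ, growthRate, iInf_subtype', (EReal.antitone_coe_sub_ennreal γ).map_ciSup_of_continuousAt
      (EReal.continuous_coe_sub_ennreal γ).continuousAt]
    exact iInf_congr fun n => hdiv n.1 n.2
  have hbS : ∀ n : ℕ, 1 ≤ n → b n ≤ n * S := fun n hn => by
    have h := le_iSup (fun n : {n : ℕ // 1 ≤ n} => b n / (n : ℕ)) ⟨n, hn⟩
    rwa [ENNReal.div_le_iff' (by exact_mod_cast (Nat.one_le_iff_ne_zero.1 hn))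
      (ENNReal.natCast_ne_top n)] at h
  have hSle : ∀ m ∈ π.invariantLifts Phat μ, S ≤ ∫⁻ z, v z ∂m := fun m hm =>
    iSup_le fun n => by
      rw [ENNReal.div_le_iff' (by exact_mod_cast (Nat.one_le_iff_ne_zero.1 n.2))
        (ENNReal.natCast_ne_top n)]
      exact minCost_le_mul_lintegral hvm n hm
  have hle : ∀ m ∈ π.invariantLifts Phat μ, extInt m φhat ≤ Λ := fun m hm => by
    rw [hlift m hm, hΛS]
    exact EReal.antitone_coe_sub_ennreal γ (hSle m hm)
  have hΛbot : ⊥ < Λ ↔ S ≠ ⊤ := by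
    rw [hΛS]
    constructor
    · intro h hS
      rw [hS] at h
      simp at h
    · intro h
      obtain ⟨s, hs⟩ : ∃ s : ℝ≥0, (s : ℝ≥0∞) = S := ⟨_, ENNReal.coe_toNNReal h⟩
      rw [← hs]
      exact EReal.bot_lt_coe ((γ : ℝ) - (s : ℝ))
  -- Lifts optimal for `n` steps up to an error `1` suffice, since `b n ≤ n * S`.
  have hmax : S ≠ ⊤ → ∃ m ∈ π.invariantLifts Phat μ, ∫⁻ z, v z ∂m ≤ S := fun hS =>
    exists_mem_invariantLifts_lintegral_le hv hvm hvP hdual hS fun n hn => by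
      obtain ⟨ν, hν, hνle⟩ := exists_lift_sum_le_minCost_add (π := π) (Phat := Phat) (μ := μ)
        hvm n one_ne_zero
      exact ⟨ν, hν, hνle.trans (add_le_add (hbS n hn) le_rfl)⟩
  have hextInt : ∀ m ∈ π.invariantLifts Phat μ, ∫⁻ z, v z ∂m ≤ S → extInt m φhat = Λ :=
    fun m hm hmS => by rw [hlift m hm, hΛS, le_antisymm hmS (hSle m hm)]
  refine ⟨?_, ?_, ?_, ?_, ?_, ?_⟩
  · rw [hΛS]
    have h := ((EReal.continuous_coe_sub_ennreal γ).tendsto S).comp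
      (ENNReal.tendsto_div_of_superadditive (b := b) (minCost_add_le hvm hdual))
    refine h.congr' ?_
    filter_upwards [eventually_ge_atTop 1] with n hn
    exact (hdiv n hn).symm
  · rw [hΛS]
    refine (EReal.sub_le_of_le_add (le_add_of_nonneg_right
      (EReal.coe_ennreal_nonneg S))).trans_lt (b := ((γ : ℝ≥0∞) : EReal)) ?_
    exact EReal.coe_lt_top (γ : ℝ)
  · refine le_antisymm ?_ (iSup₂_le hle)
    rcases eq_or_ne S ⊤ with hS | hS
    · rw [hΛS, hS]
      simp
    · obtain ⟨m, hm, hmS⟩ := hmax hS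
      rw [← hextInt m hm hmS]
      exact le_iSup₂ (f := fun m (_ : m ∈ π.invariantLifts Phat μ) => extInt m φhat) m hm
  · rintro (h | rfl)
    · obtain ⟨m, hm, -⟩ := hmax (hΛbot.1 h)
      exact ⟨m, hm⟩
    -- For empty `K` the zero cost is already adapted, so any lift of `μ` can be averaged; zero
    -- steps are requested only to obtain a lift.
    · obtain ⟨ν, hν, -⟩ := exists_lift_sum_le_minCost_add (π := π) (Phat := Phat) (μ := μ)
        (v := 0) measurable_zero 0 one_ne_zero
      obtain ⟨m, hm, -⟩ := exists_mem_invariantLifts_lintegral_le (π := π) (Phat := Phat) (μ := μ)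
        (v := 0) (S := 0) (fun t _ => ⟨∅, isOpen_empty, by simp⟩) measurable_zero
        (isAdapted_of_disjoint hi (by simp)) hdual ENNReal.zero_ne_top
        (fun n _ => ⟨ν, hν, by simp⟩)
      exact ⟨m, hm⟩
  · rintro ⟨m₀, hm₀⟩
    rcases eq_or_ne S ⊤ with hS | hS
    · have hm₀p : IsProbabilityMeasure m₀ := hm₀.1.1
      -- Every lift has the value `Λ = -∞`, so only extremality is at stake. As `v` is integrable
      -- for no lift, `u` provides the compactness.
      obtain ⟨u, hu, hum, huP, hui⟩ := π.exists_isAdapted_lintegral_ne_top Phat m₀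
      obtain ⟨m, hm, -⟩ := exists_extremePoint_isMinOn hu hum huP hm₀ hui
      exact ⟨m, hm, hextInt m hm.1 (hS ▸ le_top),
        fun he => mem_extremePoints_invariantMeasures hfactor he hm⟩
    · obtain ⟨m₁, hm₁, hm₁S⟩ := hmax hS
      obtain ⟨m, hm, hmin⟩ := exists_extremePoint_isMinOn hv hvm hvP hm₁
        (ne_top_of_le_ne_top hS hm₁S)
      exact ⟨m, hm, hextInt m hm.1 ((hmin m₁ hm₁).trans hm₁S),
        fun he => mem_extremePoints_invariantMeasures hfactor he hm⟩
  · intro h m hm hmΛ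
    have hfin : ∫⁻ z, v z ∂m ≠ ⊤ := by
      intro htop
      rw [hlift m hm, htop] at hmΛ
      rw [← hmΛ] at h
      simp at h
    -- A finite integral of `v` leaves no mass on `K`, where `v = ∞`.
    refine measure_mono_null (fun z hz => ?_) (ae_lt_top hvm hfin)
    simp [hvK z hz]
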